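/- Let $\zeta$ be a primitive fifth root of unity, $F=\mathbb{Q}(\zeta)$ and $F_0=\mathbb{Q}(\zeta+\zeta^{-1})=\mathbb{Q}(\sqrt5)$, where $\sqrt5:=1+2(\zeta+\zeta^{-1})$. Write $u=(1+\sqrt5)/2$, let $\tau$ be the nontrivial automorphism of $F_0$, and $u^\tau=(1-\sqrt5)/2$. Put $\epsilon=\zeta+\zeta^{-1}$, $\alpha=\zeta-\zeta^{-1}$, $$\gamma_P=\begin{pmatrix}-\alpha&0\\0&\alpha\end{pmatrix},\qquad \gamma_Q=\begin{pmatrix}-\alpha/\epsilon&2\\2/\epsilon&\alpha/\epsilon\end{pmatrix},$$ and $$q_{Q,P}(x,y)=\det(x\gamma_Q+y\gamma_P)=3x^2+2\sqrt5\,u^2xy+\sqrt5\,u\,y^2 .$$ Let $\mathrm{GU}_2(\mathcal{O}_{F_0})$ be the set of matrices in $\mathrm{GL}_2(F)$ with entries in $\mathcal{O}_F$ that preserve, up to a scalar in $F_0^\times$, the Hermitian form on $F^2$ with Gram matrix $\mathrm{diag}(1,(1-\sqrt5)/2)$. An element $\lambda\in\mathcal{O}_{F_0}$ is *representable by $q_{Q,P}$*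 if $\lambda=q_{Q,P}(x,y)$ for some $x,y\in F_0$ with $x\gamma_Q+y\gamma_P\in\mathrm{GU}_2(\mathcal{O}_{F_0})$. Let $q^\tau_{Q,P}$ be the form whose coefficients are the $\tau$-conjugates of those of $q_{Q,P}$; representability by $q^\tau_{Q,P}$ is defined in the same way, with $\zeta$ replaced by $\zeta^2$ (hence $\sqrt5$ by $-\sqrt5$) in the matrices and in the Hermitian form. Let $\tilde L\supset F_0$ be the splitting field of $t^4-5$ over $\mathbb{Q}$. Let $\lambda$ be a totally positive irreducible element of $\mathcal{O}_{F_0}$. 1. Suppose that $\lambda$ is relatively prime to $2\sqrt5$. Then $\lambda$ is representable by both $q_{Q,P}$ and $q^\tau_{Q,P}$ if and only if the ideal $\langle\lambda\rangle$ of $\mathcal{O}_{F_0}$ splits completely in $\tilde L$ as a product of non-principal prime ideals. 2. Suppose that $\lambda\equiv-1 \bmod 4\mathcal{O}_{F_0}$ and that $\lambda$ is representable by both $q_{Q,P}$ and $q^\tau_{Q,P}$. Then there exist $x,y,x',y'\in F_0$ with $q_{Q,P}(x,y)=\lambda$ and $q^\tau_{Q,P}(x',y')=\lambda$ such that $x_1=2x$,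 $d_1=y+ux$, $x_1'=2x'$, $d_1'=y'+u^\tau x'$ all lie in $\mathcal{O}_{F_0}$, and $(x_1,d_1)\equiv(0,u)$ and $(x_1',d_1')\equiv(0,u^\tau) \bmod 2\mathcal{O}_{F_0}$. -/

import Mathlib

open NumberField

noncomputable section

open IntermediateField Matrix

namespace QuadRep

/-- The cyclotomic field `F = ℚ(ζ₅)`. -/
abbrev F : Type := CyclotomicField 5 ℚ

instance : IsCyclotomicExtension {5} ℚ F :=
  haveI : NeZero ((5 : ℕ) : ℚ) := ⟨by norm_num⟩
  CyclotomicField.isCyclotomicExtension 5 ℚ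

/-- The primitive fifth root of unity `ζ`. -/
def zeta : F := IsCyclotomicExtension.zeta 5 ℚ F

lemma zeta_spec : IsPrimitiveRoot zeta 5 := IsCyclotomicExtension.zeta_spec 5 ℚ F

instance : IsCMField F :=
  IsCyclotomicExtension.Rat.isCMField F (S := {5}) ⟨5, rfl, by norm_num⟩

/-- The quadratic field `F₀ = ℚ(ζ + ζ⁻¹)`, that is `ℚ(√5)`. -/
abbrev F₀ : Type := ℚ⟮zeta + zeta⁻¹⟯

/-- The generator `ζ + ζ⁻¹ = (-1 + √5)/2` of `F₀`. -/
def eps₀ : F₀ := AdjoinSimple.gen ℚ (zeta + zeta⁻¹)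

/-- The square root of `5` in `F₀`. -/
def sqrt5 : F₀ := 2 * eps₀ + 1

/-- The fundamental unit `(1 + √5)/2`, as an element of `F₀`. -/
def u : F₀ := (1 + sqrt5) / 2

/-- Its conjugate `(1 - √5)/2`. -/
def uConj : F₀ := (1 - sqrt5) / 2

lemma coe_eps₀ : (eps₀ : F) = zeta + zeta⁻¹ := AdjoinSimple.coe_gen ℚ _

lemma zeta_ne_zero : zeta ≠ 0 := zeta_spec.ne_zero (by norm_num)

lemma zeta_cyclo : zeta ^ 4 + zeta ^ 3 + zeta ^ 2 + zeta + 1 = 0 := by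
  have h := zeta_spec.geom_sum_eq_zero (by norm_num)
  simp only [Finset.sum_range_succ, Finset.sum_range_zero] at h
  linear_combination h

lemma zeta_pow_five : zeta ^ 5 = 1 := zeta_spec.pow_eq_one

lemma zeta_inv : zeta⁻¹ = zeta ^ 4 :=
  inv_eq_of_mul_eq_one_right (by rw [← zeta_pow_five]; ring)

lemma eps₀_sq : eps₀ ^ 2 + eps₀ - 1 = 0 := by
  apply Subtype.ext
  push_cast
  rw [coe_eps₀, zeta_inv]
  linear_combination zeta_cyclo + (zeta ^ 3 + 2) * zeta_pow_five

lemma sqrt5_sq : sqrt5 ^ 2 = 5 := by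
  unfold sqrt5; linear_combination 4 * eps₀_sq

lemma u_isIntegral : IsIntegral ℤ u := by
  refine ⟨Polynomial.X ^ 2 - Polynomial.X - 1, by monicity!, ?_⟩
  simp only [Polynomial.eval₂_sub, Polynomial.eval₂_pow, Polynomial.eval₂_X, Polynomial.eval₂_one]
  unfold u; linear_combination (1 / 4 : F₀) * sqrt5_sq

/-- `(1 + √5)/2` as an element of the ring of integers. -/
def uInt : 𝓞 F₀ := ⟨u, u_isIntegral⟩

/-- `(1 - √5)/2` as an element of the ring of integers. -/
def uConjInt : 𝓞 F₀ := 1 - uInt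

/-- `√5` as an element of the ring of integers. -/
def sqrt5Int : 𝓞 F₀ := 2 * uInt - 1

lemma coe_uInt : (uInt : F₀) = u := rfl

lemma coe_uConjInt : (uConjInt : F₀) = uConj := by
  simp only [uConjInt, map_sub, map_one, coe_uInt, u, uConj]; ring

lemma coe_sqrt5Int : (sqrt5Int : F₀) = sqrt5 := by
  simp only [sqrt5Int, map_sub, map_mul, map_ofNat, map_one, coe_uInt, u]; ring

/-! The binary quadratic form `q` and its conjugate. -/

/-- The form `q(x, y) = 3 x² + 2 √5 u² x y + √5 u y²`. -/
def q (x y : F₀) : F₀ := 3 * x ^ 2 + 2 * sqrt5 * u ^ 2 * x * y + sqrt5 * u * y ^ 2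

/-- The form whose coefficients are the conjugates of those of `q`. -/
def qConj (x y : F₀) : F₀ :=
  3 * x ^ 2 + 2 * (-sqrt5) * uConj ^ 2 * x * y + (-sqrt5) * uConj * y ^ 2

/-! Matrices attached to a primitive fifth root of unity `z`. The choice `z = ζ` gives the form `q`;
`z = ζ²`, the image of `ζ` under an automorphism of `F` that restricts to the nontrivial
automorphism of `F₀`, gives the conjugate of all the data. -/

/-- `α = z - z⁻¹`. -/
def alpha (z : F) : F := z - z⁻¹

/-- `ε = z + z⁻¹`. -/
def eps (z : F) : F := z + z⁻¹

/-- The trace zero matrix `γ_P`. -/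
def gammaP (z : F) : Matrix (Fin 2) (Fin 2) F := !![-alpha z, 0; 0, alpha z]

/-- The trace zero matrix `γ_Q`. -/
def gammaQ (z : F) : Matrix (Fin 2) (Fin 2) F :=
  !![-(alpha z / eps z), 2; 2 / eps z, alpha z / eps z]

/-- The Gram matrix of the Hermitian form on `F²`. Here `-ε = (1 - √5)/2` for `z = ζ`. -/
def hermGram (z : F) : Matrix (Fin 2) (Fin 2) F := !![1, 0; 0, -eps z]

/-- The conjugate transpose with respect to the complex conjugation of the CM field `F`. -/
def conjTr (M : Matrix (Fin 2) (Fin 2) F) : Matrix (Fin 2) (Fin 2) F :=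
  Mᵀ.map (IsCMField.complexConj F)

/-- The invertible matrices over `F` that preserve the Hermitian form up to a scalar in `F₀ˣ`
and have entries in the ring of integers of `F`. -/
def GU₂ (z : F) : Set (Matrix (Fin 2) (Fin 2) F) :=
  {M | M.det ≠ 0 ∧ (∃ c : F₀, c ≠ 0 ∧ conjTr M * hermGram z * M = (c : F) • hermGram z) ∧
    ∀ i j, IsIntegral ℤ (M i j)}

/-- `lam` is represented by `q`. -/
def Representable (lam : 𝓞 F₀) : Prop :=
  ∃ x y : F₀, q x y = lam ∧ (x : F) • gammaQ zeta + (y : F) • gammaP zeta ∈ GU₂ zeta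

/-- `lam` is represented by the conjugate form. -/
def RepresentableConj (lam : 𝓞 F₀) : Prop :=
  ∃ x y : F₀, qConj x y = lam ∧
    (x : F) • gammaQ (zeta ^ 2) + (y : F) • gammaP (zeta ^ 2) ∈ GU₂ (zeta ^ 2)

lemma coe_two : ((2 : F₀) : F) = 2 := rfl

lemma coe_three : ((3 : F₀) : F) = 3 := rfl

lemma coe_sqrt5 : (sqrt5 : F) = 2 * zeta + 2 * zeta ^ 4 + 1 := by
  have h : (sqrt5 : F) = 2 * (eps₀ : F) + 1 := rfl
  linear_combination h + 2 * coe_eps₀ + 2 * zeta_inv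

lemma coe_sqrt5_sq : (sqrt5 : F) ^ 2 = 5 := congrArg (algebraMap F₀ F) sqrt5_sq

lemma zeta_sq_inv : (zeta ^ 2)⁻¹ = zeta ^ 3 :=
  inv_eq_of_mul_eq_one_right (by rw [← zeta_pow_five]; ring)

lemma eps_zeta : eps zeta = zeta + zeta ^ 4 := by rw [eps, zeta_inv]

lemma alpha_zeta : alpha zeta = zeta - zeta ^ 4 := by rw [alpha, zeta_inv]

lemma eps_inv : (eps zeta)⁻¹ = (1 + (sqrt5 : F)) / 2 := by
  refine inv_eq_of_mul_eq_one_right ?_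
  rw [eps_zeta, coe_sqrt5]
  linear_combination zeta_cyclo + (zeta ^ 3 + 2) * zeta_pow_five

lemma eps_sq_inv : (eps (zeta ^ 2))⁻¹ = (1 - (sqrt5 : F)) / 2 := by
  refine inv_eq_of_mul_eq_one_right ?_
  rw [eps, zeta_sq_inv, coe_sqrt5]
  linear_combination - zeta_cyclo - (zeta ^ 2 + zeta) * zeta_pow_five

lemma alpha_sq : alpha zeta ^ 2 = -((sqrt5 : F) * (1 + (sqrt5 : F)) / 2) := by
  rw [alpha_zeta]
  linear_combination (1 / 2 : F) * coe_sqrt5_sq + (1 / 2 : F) * coe_sqrt5 + zeta_cyclo +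
    (zeta ^ 3 - 2) * zeta_pow_five

lemma alpha_sq_sq : alpha (zeta ^ 2) ^ 2 = (sqrt5 : F) * (1 - (sqrt5 : F)) / 2 := by
  rw [alpha, zeta_sq_inv]
  linear_combination (1 / 2 : F) * coe_sqrt5_sq - (1 / 2 : F) * coe_sqrt5 +
    (zeta - 2) * zeta_pow_five

/-- `q(x, y)` is the determinant of `x γ_Q + y γ_P`. -/
lemma det_eq_q (x y : F₀) :
    ((x : F) • gammaQ zeta + (y : F) • gammaP zeta).det = (q x y : F₀) := by
  have h5 := coe_sqrt5_sq
  have ha := alpha_sq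
  have he := eps_inv
  simp only [gammaQ, gammaP, q, u, div_eq_mul_inv _ (eps _), he, det_fin_two, Matrix.add_apply,
    Matrix.smul_apply, smul_eq_mul, of_apply, cons_val', cons_val_zero, cons_val_one,
    cons_val_fin_one]
  push_cast [coe_two, coe_three]
  set s : F := (sqrt5 : F)
  linear_combination (-((x : F) * ((1 + s) / 2) + y) ^ 2) * ha +
    (s ^ 2 / 8 + 3 * s / 8 + 1) * (x : F) ^ 2 * h5

/-- The same for the conjugate form. -/
lemma det_eq_qConj (x y : F₀) :
    ((x : F) • gammaQ (zeta ^ 2) + (y : F) • gammaP (zeta ^ 2)).det = (qConj x y : F₀) := by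
  have h5 := coe_sqrt5_sq
  have ha := alpha_sq_sq
  have he := eps_sq_inv
  simp only [gammaQ, gammaP, qConj, uConj, div_eq_mul_inv _ (eps _), he, det_fin_two,
    Matrix.add_apply, Matrix.smul_apply, smul_eq_mul, of_apply, cons_val', cons_val_zero,
    cons_val_one, cons_val_fin_one]
  push_cast [coe_two, coe_three]
  set s : F := (sqrt5 : F)
  linear_combination (-((x : F) * ((1 - s) / 2) + y) ^ 2) * ha +
    (s ^ 2 / 8 - 3 * s / 8 + 1) * (x : F) ^ 2 * h5

/-- Positive under every embedding into `ℝ`. -/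
def TotallyPositive (lam : 𝓞 F₀) : Prop := ∀ φ : F₀ →+* ℝ, 0 < φ lam

/-- Every prime of `L` above `I` is unramified of residue degree one over `F₀`. -/
def SplitsCompletely (L : Type*) [Field L] [Algebra F₀ L] (I : Ideal (𝓞 F₀)) : Prop :=
  ∀ P ∈ I.primesOver (𝓞 L), P.ramificationIdx (𝓞 F₀) = 1 ∧ P.inertiaDeg (𝓞 F₀) = 1

/-- The ideal `I` splits completely in `L` and none of the primes above it is principal. -/
def SplitsNonPrincipal (L : Type*) [Field L] [Algebra F₀ L] (I : Ideal (𝓞 F₀)) : Prop :=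
  SplitsCompletely L I ∧ ∀ P ∈ I.primesOver (𝓞 L), ¬ P.IsPrincipal

end QuadRep

end

/-! ### Arithmetic of `ℤ[w]`, `w² = w + 1`: norm, small primes, units, rounding -/

noncomputable section

namespace QuadRep

open Real (goldenRatio goldenConj goldenRatio_sq goldenConj_sq goldenRatio_irrational
  goldenConj_irrational)

/-! Write `O = ℤ[w]` for the integers of `F₀`, `r = √5`, `x₁ = 2x`, `d₁ = y + ux`. Completing the
square gives `q = w (r d₁² - x₁²)` (`q_eq`). The matrix is automatically a similitude, with
multiplier its determinant, and it is integral exactly when `x₁` and `d₁` are. Representability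
therefore means `l = w (r b² - a²)` over `O`, the predicate `Rep`. Conjugation replaces `w, r` by `1
- w, -r`; `GoldenData` abstracts the choice of generator so that each lemma serves both forms.

Representable implies split: the two representations make `r` and `-r` squares modulo `l`, hence
also `-1`, so `l` splits completely in `L = F₀(i, √r)` (`splitsCompletely`). If a prime above `l`
were generated by `π`, the norm of `π` would be `l` times a totally positive unit, hence times a
square, while four times it has the form `a² - r e²`. So `l` would be a square modulo `√5`. But
`Rep` gives `l ≡ 2a²`, and `2` is not a square modulo `5` (`BiquadData.not_isPrincipal`).

Split implies representable: now `-1` and `r` are squares modulo `l`. Reduction of binary forms over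
`O` (`isPrincipal_form`) shows that `l` is, up to units, a norm from `O[i]` and from `O[√r]`. Signs
leave either `Rep` or `l = c² - r e²`, together with `l = x² + y²`. In the second case `(c + x)(c -
x) = y² + r e²` is a factorization in the principal ring `O[√-r]`. A gcd there produces `j² + k²`
whose norm is `l` times a square (`exists_sq_add_sq_norm`). As `j² + k² = (j + ik)(j - ik)`, this
makes `l`, up to a unit, a norm from `L`, so some prime above `l` is principal
(`isPrincipal_of_intNorm`).

The congruence statement is a computation modulo `4`: a representation has one of two residue types
modulo `2`, and a unit of relative norm `1` in `O[√r]` exchanges them (`exists_rep_mod_two`). -/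

/-- The ring `ℤ[w]` with `w² = w + 1`, together with its two real embeddings, ordered so that the
first one maps `w` to the golden ratio. -/
structure GoldenData (O : Type*) [CommRing O] where
  /-- the generator -/
  w : O
  w_sq : w ^ 2 = w + 1
  span : ∀ x : O, ∃ m n : ℤ, x = m + n * w
  /-- the embedding with `w ↦ (1 + √5) / 2` -/
  φ : O →+* ℝ
  /-- the embedding with `w ↦ (1 - √5) / 2` -/
  ψ : O →+* ℝ
  φ_w : φ w = goldenRatio
  ψ_w : ψ w = goldenConj

namespace GoldenData

variable {O : Type*} [CommRing O] (d : GoldenData O)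

/-- The same ring with the conjugate generator. -/
def conj : GoldenData O where
  w := 1 - d.w
  w_sq := by linear_combination d.w_sq
  span x := by
    obtain ⟨m, n, rfl⟩ := d.span x
    exact ⟨m + n, -n, by push_cast; ring⟩
  φ := d.ψ
  ψ := d.φ
  φ_w := by rw [map_sub, map_one, d.ψ_w, Real.one_sub_goldenRatio]
  ψ_w := by rw [map_sub, map_one, d.φ_w, Real.one_sub_goldenConj]

/-- The square root `2 w - 1` of `5`. -/
def r : O := 2 * d.w - 1

lemma r_sq : d.r ^ 2 = 5 := by unfold r; linear_combination 4 * d.w_sq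

lemma conj_r : d.conj.r = -d.r := by simp only [r, conj]; ring

lemma φ_r : d.φ d.r = √5 := by
  simp only [r, map_sub, map_mul, map_ofNat, map_one, d.φ_w, goldenRatio]; ring

lemma ψ_r : d.ψ d.r = -√5 := by
  simp only [r, map_sub, map_mul, map_ofNat, map_one, d.ψ_w, goldenConj]; ring

lemma φ_injective : Function.Injective d.φ := by
  rw [injective_iff_map_eq_zero]
  intro x hx
  obtain ⟨m, n, rfl⟩ := d.span x
  simp only [map_add, map_intCast, map_mul, d.φ_w] at hx
  have hn : n = 0 := by
    by_contra hn
    have := (goldenRatio_irrational.intCast_mul hn).intCast_add m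
    rw [hx] at this
    exact not_irrational_zero this
  subst hn
  simp only [Int.cast_zero, zero_mul, add_zero, Int.cast_eq_zero] at hx
  simp [hx]

lemma ψ_injective : Function.Injective d.ψ := d.conj.φ_injective

include d in
lemma isDomain : IsDomain O := d.φ_injective.isDomain d.φ

/-- The norm to `ℤ`. -/
def nrm (x : O) : ℤ := round (d.φ x * d.ψ x)

lemma mul_emb (m n : ℤ) : d.φ (m + n * d.w) * d.ψ (m + n * d.w) =
    ((m ^ 2 + m * n - n ^ 2 : ℤ) : ℝ) := by
  simp only [map_add, map_intCast, map_mul, d.φ_w, d.ψ_w]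
  push_cast
  linear_combination (m * n : ℝ) * Real.goldenRatio_add_goldenConj +
    (n ^ 2 : ℝ) * Real.goldenRatio_mul_goldenConj

lemma nrm_coords (m n : ℤ) : d.nrm (m + n * d.w) = m ^ 2 + m * n - n ^ 2 := by
  rw [nrm, mul_emb, round_intCast]

lemma coe_nrm (x : O) : (d.nrm x : ℝ) = d.φ x * d.ψ x := by
  obtain ⟨m, n, rfl⟩ := d.span x
  rw [nrm_coords, mul_emb]

lemma nrm_mul (x y : O) : d.nrm (x * y) = d.nrm x * d.nrm y := by
  have h : (d.nrm (x * y) : ℝ) = d.nrm x * d.nrm y := by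
    simp only [coe_nrm, map_mul]; ring
  exact_mod_cast h

lemma nrm_neg (x : O) : d.nrm (-x) = d.nrm x := by simp [nrm]

lemma nrm_intCast (m : ℤ) : d.nrm m = m ^ 2 := by simpa using d.nrm_coords m 0

lemma nrm_eq_zero {x : O} : d.nrm x = 0 ↔ x = 0 := by
  constructor
  · intro h
    have h' := d.coe_nrm x
    rw [h, Int.cast_zero, eq_comm, mul_eq_zero] at h'
    rcases h' with h' | h'
    · exact (map_eq_zero_iff _ d.φ_injective).1 h'
    · exact (map_eq_zero_iff _ d.ψ_injective).1 h'
  · rintro rfl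
    simpa using d.nrm_intCast 0

lemma exists_mul_eq_nrm (x : O) : ∃ y, x * y = d.nrm x := by
  obtain ⟨m, n, rfl⟩ := d.span x
  refine ⟨m + n * (1 - d.w), ?_⟩
  rw [nrm_coords]
  push_cast
  linear_combination (-n ^ 2 : O) * d.w_sq

lemma isUnit_of_natAbs {x : O} (h : (d.nrm x).natAbs = 1) : IsUnit x := by
  obtain ⟨y, hy⟩ := d.exists_mul_eq_nrm x
  rcases Int.natAbs_eq_iff.1 h with h | h
  · exact .of_mul_eq_one y (by rw [hy, h]; simp)
  · exact .of_mul_eq_one (-y) (by rw [mul_neg, hy, h]; simp)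

lemma nrm_natAbs_of_isUnit {x : O} (h : IsUnit x) : (d.nrm x).natAbs = 1 := by
  obtain ⟨y, hy⟩ := h.exists_right_inv
  have h1 := d.nrm_mul x y
  rw [hy, show d.nrm 1 = 1 by simpa using d.nrm_intCast 1] at h1
  exact Int.isUnit_iff_natAbs_eq.1 (.of_mul_eq_one _ h1.symm)

lemma isUnit_iff {x : O} : IsUnit x ↔ (d.nrm x).natAbs = 1 :=
  ⟨d.nrm_natAbs_of_isUnit, d.isUnit_of_natAbs⟩

lemma nrm_w : d.nrm d.w = -1 := by simpa using d.nrm_coords 0 1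

lemma nrm_r : d.nrm d.r = -5 := by
  have := d.nrm_coords (-1) 2
  norm_num at this
  rw [← this, r]; congr 1; ring

lemma isUnit_w : IsUnit d.w := d.isUnit_iff.2 (by rw [nrm_w]; rfl)

lemma nrm_dvd {x y : O} (h : x ∣ y) : d.nrm x ∣ d.nrm y := by
  obtain ⟨z, rfl⟩ := h
  exact ⟨_, d.nrm_mul _ _⟩

/-! Divisibility by `2` and by `√5`. -/

lemma mod_two (x : O) : (2 : O) ∣ x ∨ (2 : O) ∣ x - 1 ∨ 2 ∣ x - d.w ∨ 2 ∣ x - (d.w + 1) := by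
  obtain ⟨m, n, rfl⟩ := d.span x
  rcases Int.even_or_odd' m with ⟨k, rfl | rfl⟩ <;> rcases Int.even_or_odd' n with ⟨l, rfl | rfl⟩
  · exact .inl ⟨k + l * d.w, by push_cast; ring⟩
  · exact .inr (.inr (.inl ⟨k + l * d.w, by push_cast; ring⟩))
  · exact .inr (.inl ⟨k + l * d.w, by push_cast; ring⟩)
  · exact .inr (.inr (.inr ⟨k + l * d.w, by push_cast; ring⟩))

include d in
lemma not_two_dvd_of_isUnit {x : O} (hx : IsUnit x) : ¬ (2 : O) ∣ x := fun h ↦ by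
  have h1 := d.nrm_dvd h
  rw [show d.nrm 2 = 4 by simpa using d.nrm_intCast 2] at h1
  have h2 := d.nrm_natAbs_of_isUnit hx
  omega

include d in
lemma exists_inv_mod_two {x : O} (hx : ¬ (2 : O) ∣ x) : ∃ y, (2 : O) ∣ x * y - 1 := by
  rcases d.mod_two x with h | h | ⟨c, h⟩ | ⟨c, h⟩
  · exact absurd h hx
  · exact ⟨1, by simpa using h⟩
  · exact ⟨d.w - 1, c * (d.w - 1), by linear_combination (d.w - 1) * h + d.w_sq⟩
  · exact ⟨2 - d.w, c * (2 - d.w), by linear_combination (2 - d.w) * h - d.w_sq⟩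

-- `2` is inert: the nonzero residues `1`, `w`, `w + 1` are all invertible modulo `2`.
include d in
lemma prime_two : Prime (2 : O) := by
  have := d.isDomain
  refine ⟨fun h ↦ ?_, fun h ↦ d.not_two_dvd_of_isUnit h dvd_rfl, fun a b hab ↦ ?_⟩
  · have := congrArg d.φ h
    rw [map_ofNat, map_zero] at this
    norm_num at this
  · by_contra! h
    obtain ⟨y, hy⟩ := d.exists_inv_mod_two h.1
    refine h.2 ?_
    have : b = y * (a * b) - (a * y - 1) * b := by ring
    rw [this]
    exact dvd_sub (hab.mul_left _) (hy.mul_right _)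

/-- The residue field at `√5` is `𝔽₅`, and `2w ≡ 1` there, so `w ≡ 3`. -/
lemma exists_int_mod_r (x : O) : ∃ k : ℤ, d.r ∣ x - k := by
  obtain ⟨m, n, rfl⟩ := d.span x
  refine ⟨m + 3 * n, n * (1 - d.w), ?_⟩
  unfold r
  push_cast
  linear_combination (2 * n : O) * d.w_sq

lemma r_dvd_intCast {k : ℤ} : d.r ∣ (k : O) ↔ 5 ∣ k := by
  constructor
  · intro h
    have h1 := d.nrm_dvd h
    rw [nrm_r, nrm_intCast, neg_dvd] at h1
    exact (by norm_num : Prime (5 : ℤ)).dvd_of_dvd_pow h1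
  · rintro ⟨l, rfl⟩
    exact ⟨d.r * l, by push_cast; linear_combination (-l : O) * d.r_sq⟩

lemma prime_r : Prime d.r := by
  have := d.isDomain
  refine ⟨fun h ↦ ?_, fun h ↦ ?_, fun a b hab ↦ ?_⟩
  · have := d.nrm_r; rw [h, d.nrm_eq_zero.2 rfl] at this; simp at this
  · have := d.nrm_natAbs_of_isUnit h; rw [nrm_r] at this; simp at this
  · obtain ⟨k, hk⟩ := d.exists_int_mod_r a
    obtain ⟨l, hl⟩ := d.exists_int_mod_r b
    have h1 : d.r ∣ ((k * l : ℤ) : O) := by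
      have : ((k * l : ℤ) : O) = a * b - (a - k) * b - k * (b - l) := by push_cast; ring
      rw [this]
      exact dvd_sub (dvd_sub hab (hk.mul_right _)) (hl.mul_left _)
    rw [r_dvd_intCast] at h1
    rcases (by norm_num : Prime (5 : ℤ)).dvd_or_dvd h1 with h | h
    · exact .inl ((dvd_sub_left (d.r_dvd_intCast.2 h)).1 hk)
    · exact .inr ((dvd_sub_left (d.r_dvd_intCast.2 h)).1 hl)

/-- Modulo `√5` this says that `2` is not a square in `𝔽₅`. -/
lemma r_dvd_of_sq_sub_two_sq {x y : O} (h : d.r ∣ x ^ 2 - 2 * y ^ 2) : d.r ∣ y := by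
  obtain ⟨k, hk⟩ := d.exists_int_mod_r x
  obtain ⟨l, hl⟩ := d.exists_int_mod_r y
  have h1 : d.r ∣ ((k ^ 2 - 2 * l ^ 2 : ℤ) : O) := by
    have : ((k ^ 2 - 2 * l ^ 2 : ℤ) : O) = x ^ 2 - 2 * y ^ 2 - (x - k) * (x + k)
      + (y - l) * (2 * (y + l)) := by push_cast; ring
    rw [this]
    exact dvd_add (dvd_sub h (hk.mul_right _)) (hl.mul_right _)
  rw [r_dvd_intCast] at h1
  refine (dvd_sub_left (d.r_dvd_intCast.2 ?_)).1 hl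
  have h2 : ((k ^ 2 - 2 * l ^ 2 : ℤ) : ZMod 5) = 0 := (ZMod.intCast_zmod_eq_zero_iff_dvd _ 5).2 h1
  refine (ZMod.intCast_zmod_eq_zero_iff_dvd l 5).1 ?_
  push_cast at h2
  generalize (k : ZMod 5) = a at *
  generalize (l : ZMod 5) = b at *
  revert a b
  decide

lemma r_dvd_w_sub_three : d.r ∣ d.w - 3 :=
  ⟨1 - d.w, by unfold r; linear_combination 2 * d.w_sq⟩

/-! Units. -/

lemma exists_trace_int (x : O) : ∃ k : ℤ, d.φ x + d.ψ x = k := by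
  obtain ⟨m, n, rfl⟩ := d.span x
  refine ⟨2 * m + n, ?_⟩
  simp only [map_add, map_intCast, map_mul, d.φ_w, d.ψ_w]
  push_cast
  linear_combination (n : ℝ) * Real.goldenRatio_add_goldenConj

/-- The unit `w`. -/
def wUnit : Oˣ := d.isUnit_w.unit

lemma φ_zpow (k : ℤ) : d.φ ((d.wUnit ^ k : Oˣ) : O) = goldenRatio ^ k := by
  have h := map_zpow (Units.map (d.φ : O →* ℝ)) d.wUnit k
  have h' := congrArg Units.val h
  simp only [Units.coe_map, Units.val_zpow_eq_zpow_val] at h'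
  rw [← d.φ_w]
  exact h'

lemma ψ_zpow (k : ℤ) : d.ψ ((d.wUnit ^ k : Oˣ) : O) = goldenConj ^ k := by
  have h := map_zpow (Units.map (d.ψ : O →* ℝ)) d.wUnit k
  have h' := congrArg Units.val h
  simp only [Units.coe_map, Units.val_zpow_eq_zpow_val] at h'
  rw [← d.ψ_w]
  exact h'

/-- Multiplying by an even power of `w` moves the first embedding into `[1/g, g)`, with `g` the
golden ratio. The norm is `1`, so the trace is an integer that is at least `2` and less than `3`. It
equals `2`, and the scaled unit is `1`. -/
lemma unit_eq_sq_of_pos {ε : O} (hε : IsUnit ε) (h1 : 0 < d.φ ε) (h2 : 0 < d.ψ ε) :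
    ∃ η : O, IsUnit η ∧ ε = η ^ 2 := by
  set g := goldenRatio with hg
  have g1 : 1 < g := Real.one_lt_goldenRatio
  have g0 : 0 < g := by linarith
  have g2 : g ^ 2 = g + 1 := goldenRatio_sq
  obtain ⟨n, hn1, hn2⟩ := exists_mem_Ico_zpow (x := d.φ ε * g) (y := g ^ 2) (by positivity)
    (by nlinarith)
  set v : Oˣ := d.wUnit ^ (-n) with hv
  have hφv : d.φ v * g ^ n = 1 := by
    rw [hv, φ_zpow, ← zpow_add₀ g0.ne', neg_add_cancel, zpow_zero]
  have hvne : d.φ v ≠ 0 := left_ne_zero_of_mul_eq_one hφv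
  have hψne : d.ψ v ≠ 0 := by
    have := v.isUnit.map d.ψ
    exact this.ne_zero
  set e : O := ε * v ^ 2 with he
  have heu : IsUnit e := hε.mul (v.isUnit.pow 2)
  have hfv : d.φ v ^ 2 * (g ^ 2) ^ n = 1 := by
    have : (g ^ 2) ^ n = (g ^ n) ^ 2 := by
      rw [← zpow_natCast, ← zpow_natCast, ← zpow_mul, ← zpow_mul, mul_comm]
    rw [this, ← mul_pow, hφv, one_pow]
  have hf1 : 1 ≤ d.φ e * g := by
    have : d.φ e * g = d.φ ε * g * d.φ v ^ 2 := by rw [he]; simp only [map_mul, map_pow]; ring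
    rw [this, ← hfv, mul_comm (d.φ v ^ 2)]
    exact mul_le_mul_of_nonneg_right hn1 (sq_nonneg _)
  have hf2 : d.φ e < g := by
    have h3 : d.φ e * g = d.φ ε * g * d.φ v ^ 2 := by rw [he]; simp only [map_mul, map_pow]; ring
    have h4 : d.φ ε * g * d.φ v ^ 2 < (g ^ 2) ^ (n + 1) * d.φ v ^ 2 :=
      mul_lt_mul_of_pos_right hn2 (by positivity)
    rw [← h3, zpow_add₀ (by positivity), zpow_one] at h4
    have h5 : d.φ e * g < g * g := by linear_combination h4 + g ^ 2 * hfv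
    exact lt_of_mul_lt_mul_right h5 g0.le
  have hp1 : 0 < d.φ e := by rw [he]; simp only [map_mul, map_pow]; positivity
  have hp2 : 0 < d.ψ e := by rw [he]; simp only [map_mul, map_pow]; positivity
  have hN : d.φ e * d.ψ e = 1 := by
    have h3 := d.nrm_natAbs_of_isUnit heu
    rw [← coe_nrm]
    have h4 : (0 : ℝ) < d.nrm e := by rw [coe_nrm]; positivity
    have h5 : 0 < d.nrm e := by exact_mod_cast h4
    have h6 : d.nrm e = 1 := by omega
    rw [h6, Int.cast_one]
  obtain ⟨k, hk⟩ := d.exists_trace_int e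
  have ge : g * (1 - g) = -1 := by linarith
  have hk1 : (k : ℝ) < 3 := by
    rw [← hk]
    have h7 : d.ψ e ≤ g := by
      by_contra! h
      have : d.φ e * g < d.φ e * d.ψ e := mul_lt_mul_of_pos_left h hp1
      linarith
    have g3 : g < 1.7 := by nlinarith
    nlinarith [mul_nonneg (sub_nonneg.2 hf2.le) (sub_nonneg.2 h7)]
  have hk2 : (2 : ℝ) ≤ k := by
    rw [← hk]; nlinarith [sq_nonneg (d.φ e - d.ψ e)]
  have hk3 : k = 2 := by
    have h1 : k < 3 := by exact_mod_cast hk1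
    have h2 : 2 ≤ k := by exact_mod_cast hk2
    omega
  rw [hk3] at hk
  have he1 : d.φ e = 1 := by
    have : (d.φ e - 1) ^ 2 = 0 := by push_cast at hk; linear_combination d.φ e * hk - hN
    linarith [pow_eq_zero_iff (two_ne_zero) |>.1 this]
  have he2 : e = 1 := d.φ_injective (by rw [he1, map_one])
  refine ⟨(v⁻¹ : Oˣ), Units.isUnit _, ?_⟩
  calc ε = ε * (v * (v⁻¹ : Oˣ)) ^ 2 := by simp
    _ = e * ((v⁻¹ : Oˣ) : O) ^ 2 := by rw [he]; ring
    _ = _ := by rw [he2, one_mul]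

/-- The unit `-w` is negative under `φ` and positive under `ψ`, so it corrects the one sign left
free. -/
lemma unit_eq_of_ψ_pos {ε : O} (hε : IsUnit ε) (h : 0 < d.ψ ε) :
    (∃ η : O, IsUnit η ∧ ε = η ^ 2) ∨ ∃ η : O, IsUnit η ∧ ε = -(d.w * η ^ 2) := by
  have hφ : d.φ ε ≠ 0 := (hε.map d.φ).ne_zero
  rcases hφ.lt_or_gt with h1 | h1
  · right
    have hw1 : 0 < d.φ d.w := by rw [φ_w]; exact Real.goldenRatio_pos
    have hw2 : d.ψ d.w < 0 := by rw [ψ_w]; exact Real.goldenConj_neg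
    obtain ⟨η, hη, h2⟩ := d.unit_eq_sq_of_pos (ε := -(d.w * ε)) (d.isUnit_w.mul hε).neg
      (by rw [map_neg, map_mul]; nlinarith) (by rw [map_neg, map_mul]; nlinarith)
    have hw : d.w * (d.w - 1) = 1 := by linear_combination d.w_sq
    refine ⟨η * (d.w - 1), hη.mul (.of_mul_eq_one d.w (by rw [mul_comm]; exact hw)), ?_⟩
    linear_combination (-(d.w - 1) ^ 2 * d.w) * h2 + (-ε - d.w * (d.w - 1) * ε) * hw
  · exact .inl (d.unit_eq_sq_of_pos hε h1 h)

/-! Rounding. -/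

/-- Rounding the `w`-coordinate first and then the other leaves errors `v ± s√5/2` with `|s|, |v| ≤
1/2`. Their product is `v² - 5s²/4` and the sum of their squares is `2v² + 5s²/2`, whence `5/16` and
`9/8`. -/
lemma exists_near (x y : ℝ) : ∃ t : O, |(x - d.φ t) * (y - d.ψ t)| ≤ 5 / 16 ∧
    (x - d.φ t) ^ 2 + (y - d.ψ t) ^ 2 ≤ 9 / 8 := by
  have h5 : (√5 : ℝ) ^ 2 = 5 := Real.sq_sqrt (by norm_num)
  have hs : (√5 : ℝ) ≠ 0 := by positivity
  set n : ℤ := round ((x - y) / √5)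
  set s : ℝ := (x - y) / √5 - n with hs'
  have hs1 : |s| ≤ 1 / 2 := abs_sub_round _
  set c : ℝ := (x + y) / 2 - n / 2
  set m : ℤ := round c
  set v : ℝ := c - m with hv'
  have hv1 : |v| ≤ 1 / 2 := abs_sub_round _
  have hxy : x - y = √5 * (s + n) := by rw [hs']; field_simp; ring
  have hx : x - d.φ (m + n * d.w) = v + s * √5 / 2 := by
    simp only [map_add, map_intCast, map_mul, d.φ_w, goldenRatio]
    rw [hv']; simp only [c]; linear_combination hxy / 2
  have hy : y - d.ψ (m + n * d.w) = v - s * √5 / 2 := by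
    simp only [map_add, map_intCast, map_mul, d.ψ_w, goldenConj]
    rw [hv']; simp only [c]; linear_combination -hxy / 2
  have hs2 : s ^ 2 ≤ 1 / 4 := by rw [← sq_abs]; nlinarith [abs_nonneg s]
  have hv2 : v ^ 2 ≤ 1 / 4 := by rw [← sq_abs]; nlinarith [abs_nonneg v]
  refine ⟨m + n * d.w, ?_, ?_⟩
  · rw [hx, hy]
    have : (v + s * √5 / 2) * (v - s * √5 / 2) = v ^ 2 - 5 / 4 * s ^ 2 := by
      linear_combination (-s ^ 2 / 4) * h5
    rw [this, abs_le]
    constructor <;> nlinarith [sq_nonneg s, sq_nonneg v]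
  · rw [hx, hy]
    have : (v + s * √5 / 2) ^ 2 + (v - s * √5 / 2) ^ 2 = 2 * v ^ 2 + 5 / 2 * s ^ 2 := by
      linear_combination (s ^ 2 / 2) * h5
    rw [this]; nlinarith

/-- Division with remainder. -/
lemma exists_rem (x : O) {y : O} (hy : y ≠ 0) :
    ∃ t : O, (d.nrm (x - t * y)).natAbs < (d.nrm y).natAbs := by
  have h1 : d.φ y ≠ 0 := (map_ne_zero_iff _ d.φ_injective).2 hy
  have h2 : d.ψ y ≠ 0 := (map_ne_zero_iff _ d.ψ_injective).2 hy
  obtain ⟨t, ht, -⟩ := d.exists_near (d.φ x / d.φ y) (d.ψ x / d.ψ y)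
  refine ⟨t, ?_⟩
  have h3 : ((d.nrm (x - t * y)).natAbs : ℝ) < (d.nrm y).natAbs := by
    rw [Nat.cast_natAbs, Nat.cast_natAbs, Int.cast_abs, Int.cast_abs, coe_nrm, coe_nrm]
    have : d.φ (x - t * y) * d.ψ (x - t * y) = ((d.φ x / d.φ y - d.φ t) *
        (d.ψ x / d.ψ y - d.ψ t)) * (d.φ y * d.ψ y) := by
      simp only [map_sub, map_mul]; field_simp
    rw [this, abs_mul]
    have h4 : 0 < |d.φ y * d.ψ y| := abs_pos.2 (mul_ne_zero h1 h2)
    nlinarith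
  exact_mod_cast h3

include d in
lemma isPrincipalIdealRing : IsPrincipalIdealRing O := by
  refine ⟨fun I ↦ ?_⟩
  by_cases hI : I = ⊥
  · subst hI; exact ⟨0, by simp⟩
  obtain ⟨y₀, hy₀, hy₀'⟩ := Submodule.exists_mem_ne_zero_of_ne_bot hI
  obtain ⟨y, ⟨hyI, hy⟩, hmin⟩ := WellFounded.has_min
    (InvImage.wf (fun x ↦ (d.nrm x).natAbs) Nat.lt_wfRel.wf) {y | y ∈ I ∧ y ≠ 0} ⟨y₀, hy₀, hy₀'⟩
  refine ⟨y, le_antisymm (fun x hx ↦ ?_) ((Ideal.span_singleton_le_iff_mem I).2 hyI)⟩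
  obtain ⟨t, ht⟩ := d.exists_rem x hy
  have h1 : x - t * y ∈ I := I.sub_mem hx (I.mul_mem_left _ hyI)
  by_cases h2 : x - t * y = 0
  · exact Ideal.mem_span_singleton'.2 ⟨t, (sub_eq_zero.1 h2).symm⟩
  · exact absurd ht (hmin _ ⟨h1, h2⟩)

end GoldenData

end QuadRep

end

/-! ### Reduction of binary quadratic forms over `ℤ[w]` -/

noncomputable section

namespace QuadRep

open Real (goldenRatio goldenConj)

namespace GoldenData

variable {O : Type*} [CommRing O] (d : GoldenData O)

set_option maxHeartbeats 800000 in
/-- A bound for the reduction of the binary quadratic form `(A, B, C)` with `B² - AC = D`. -/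
lemma exists_reduction {D A : O} (B : O) (hA : A ≠ 0) {δ : ℝ} (h1 : |d.φ D| ≤ δ)
    (h2 : |d.ψ D| ≤ δ) (h : 25 / 256 * ((d.nrm A).natAbs : ℝ) ^ 2 +
      9 / 8 * δ * goldenRatio * (d.nrm A).natAbs + δ ^ 2 < ((d.nrm A).natAbs : ℝ) ^ 2) :
    ∃ t : O, (d.nrm ((B - t * A) ^ 2 - D)).natAbs < (d.nrm A).natAbs ^ 2 := by
  set g := goldenRatio
  have g1 : 1 < g := Real.one_lt_goldenRatio
  have g0 : 0 < g := by linarith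
  have hδ : 0 ≤ δ := (abs_nonneg _).trans h1
  have hφA : 0 < |d.φ A| := abs_pos.2 ((map_ne_zero_iff _ d.φ_injective).2 hA)
  have hψA : 0 < |d.ψ A| := abs_pos.2 ((map_ne_zero_iff _ d.ψ_injective).2 hA)
  -- Multiplying `A` by a power of `w` makes its two absolute values agree up to a factor `g`, so
  -- that the square of each is at most `g` times the absolute norm of `A`.
  obtain ⟨n, hn1, hn2⟩ := exists_mem_Ico_zpow (x := |d.φ A| / |d.ψ A| * g) (y := g ^ 2)
    (by positivity) (by nlinarith)
  set v : Oˣ := d.wUnit ^ (-n) with hv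
  have hφv : |d.φ v| = (g ^ n)⁻¹ := by
    rw [hv, φ_zpow, abs_of_pos (by positivity), zpow_neg]
  have hψv : |d.ψ v| = g ^ n := by
    have : |goldenConj| = g⁻¹ := by
      rw [Real.inv_goldenRatio, abs_of_neg Real.goldenConj_neg]
    rw [hv, ψ_zpow, abs_zpow, this, inv_zpow', neg_neg]
  set a := d.φ (A * v) with ha
  set b := d.ψ (A * v) with hb
  have ha' : |a| = |d.φ A| * (g ^ n)⁻¹ := by rw [ha, map_mul, abs_mul, hφv]
  have hb' : |b| = |d.ψ A| * g ^ n := by rw [hb, map_mul, abs_mul, hψv]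
  have hgn : 0 < g ^ n := zpow_pos g0 n
  have hsq : (g ^ 2) ^ n = g ^ n * g ^ n := by
    rw [← zpow_natCast, ← zpow_mul, ← zpow_add₀ g0.ne']; congr 1; push_cast; ring
  rw [hsq, div_mul_eq_mul_div, le_div_iff₀ hψA] at hn1
  rw [zpow_add₀ (by positivity), zpow_one, hsq, div_mul_eq_mul_div, div_lt_iff₀ hψA] at hn2
  have hab1 : |b| ≤ g * |a| := by
    rw [ha', hb', ← mul_assoc, ← div_eq_mul_inv, le_div_iff₀ hgn]; linarith
  have hab2 : |a| ≤ g * |b| := by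
    rw [ha', hb', ← div_eq_mul_inv, div_le_iff₀ hgn]
    refine le_of_mul_le_mul_right (hn2.le.trans_eq ?_) g0
    ring
  have hN : |a| * |b| = (d.nrm A).natAbs := by
    rw [Nat.cast_natAbs, Int.cast_abs, coe_nrm, ha', hb', abs_mul]; field_simp
  have ha0 : 0 < |a| := by rw [ha']; positivity
  have hb0 : 0 < |b| := by rw [hb']; positivity
  rw [← hN] at h
  have haa : a ^ 2 ≤ g * (|a| * |b|) := by
    rw [← sq_abs]
    linear_combination |a| * hab2
  have hbb : b ^ 2 ≤ g * (|a| * |b|) := by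
    rw [← sq_abs]
    linear_combination |b| * hab1
  obtain ⟨t, ht1, ht2⟩ := d.exists_near (d.φ B / a) (d.ψ B / b)
  refine ⟨t * v, ?_⟩
  set x := d.φ B / a - d.φ t
  set y := d.ψ B / b - d.ψ t
  have hx : d.φ ((B - t * v * A) ^ 2 - D) = x ^ 2 * a ^ 2 - d.φ D := by
    have : x * a = d.φ B - d.φ t * a := by
      simp only [x]; field_simp [abs_pos.1 ha0]
    rw [← mul_pow, this, ha]; simp only [map_sub, map_mul, map_pow]; ring
  have hy : d.ψ ((B - t * v * A) ^ 2 - D) = y ^ 2 * b ^ 2 - d.ψ D := by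
    have : y * b = d.ψ B - d.ψ t * b := by
      simp only [y]; field_simp [abs_pos.1 hb0]
    rw [← mul_pow, this, hb]; simp only [map_sub, map_mul, map_pow]; ring
  have key : ((d.nrm ((B - t * v * A) ^ 2 - D)).natAbs : ℝ) < ((d.nrm A).natAbs : ℝ) ^ 2 := by
    rw [Nat.cast_natAbs, Int.cast_abs, coe_nrm, ← hN, hx, hy, abs_mul]
    refine lt_of_le_of_lt ?_ h
    have e1 : |x ^ 2 * a ^ 2 - d.φ D| ≤ x ^ 2 * a ^ 2 + δ :=
      (abs_sub _ _).trans (add_le_add (abs_of_nonneg (by positivity)).le h1)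
    have e2 : |y ^ 2 * b ^ 2 - d.ψ D| ≤ y ^ 2 * b ^ 2 + δ :=
      (abs_sub _ _).trans (add_le_add (abs_of_nonneg (by positivity)).le h2)
    refine (mul_le_mul e1 e2 (abs_nonneg _) (by positivity)).trans ?_
    have e3 : (x ^ 2 * a ^ 2 + δ) * (y ^ 2 * b ^ 2 + δ) = (x * y) ^ 2 * (|a| * |b|) ^ 2 +
        δ * (x ^ 2 * a ^ 2 + y ^ 2 * b ^ 2) + δ ^ 2 := by
      rw [mul_pow |a|, sq_abs, sq_abs]; ring
    have e4 : (x * y) ^ 2 ≤ 25 / 256 := by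
      rw [← sq_abs]
      exact (pow_le_pow_left₀ (abs_nonneg _) ht1 2).trans (by norm_num)
    have e5 : x ^ 2 * a ^ 2 + y ^ 2 * b ^ 2 ≤ 9 / 8 * (g * (|a| * |b|)) := by
      calc x ^ 2 * a ^ 2 + y ^ 2 * b ^ 2 ≤ x ^ 2 * (g * (|a| * |b|)) + y ^ 2 * (g * (|a| * |b|)) := by
            gcongr
        _ = (x ^ 2 + y ^ 2) * (g * (|a| * |b|)) := by ring
        _ ≤ _ := by gcongr
    rw [e3]
    have e6 := mul_le_mul_of_nonneg_right e4 (sq_nonneg (|a| * |b|))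
    have e7 := mul_le_mul_of_nonneg_left e5 hδ
    linarith
  exact_mod_cast key

/-- Every binary form `(A, B, C)` with `B² - AC = D` and non-unit `A` can be reduced. -/
def Reducible (D : O) : Prop :=
  ∀ A B : O, A ≠ 0 → ¬ IsUnit A → A ∣ B ^ 2 - D →
    ∃ t : O, (d.nrm ((B - t * A) ^ 2 - D)).natAbs < (d.nrm A).natAbs ^ 2

lemma nrm_mod_four (x : O) : d.nrm x % 4 ≠ 2 := by
  obtain ⟨m, n, rfl⟩ := d.span x
  rw [nrm_coords]
  intro h
  have h2 : ((m ^ 2 + m * n - n ^ 2 : ℤ) : ZMod 4) = ((2 : ℤ) : ZMod 4) := by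
    rw [ZMod.intCast_eq_intCast_iff_dvd_sub]; omega
  push_cast at h2
  generalize (m : ZMod 4) = a at *
  generalize (n : ZMod 4) = b at *
  revert a b
  decide

/-- Four times the norm is `(2m + n)² - 5n²`, so a norm is a square modulo `5`, and `±3` is not. -/
lemma nrm_eq_three {x : O} (h : (d.nrm x).natAbs = 3) : False := by
  obtain ⟨m, n, rfl⟩ := d.span x
  rw [nrm_coords] at h
  have h2 : ((m ^ 2 + m * n - n ^ 2 : ℤ) : ZMod 5) = 3 ∨
      ((m ^ 2 + m * n - n ^ 2 : ℤ) : ZMod 5) = -3 := by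
    rcases Int.natAbs_eq_iff.1 h with h | h <;> rw [h]
    · left; rfl
    · right; rfl
  push_cast at h2
  generalize (m : ZMod 5) = a at *
  generalize (n : ZMod 5) = b at *
  revert a b
  decide

lemma two_dvd_of_even_nrm {x : O} (h : 2 ∣ d.nrm x) : (2 : O) ∣ x := by
  obtain ⟨m, n, rfl⟩ := d.span x
  rw [nrm_coords] at h
  have h2 : ((m ^ 2 + m * n - n ^ 2 : ℤ) : ZMod 2) = 0 := by
    rw [ZMod.intCast_zmod_eq_zero_iff_dvd]; exact_mod_cast h
  have h3 : (m : ZMod 2) = 0 ∧ (n : ZMod 2) = 0 := by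
    push_cast at h2
    generalize (m : ZMod 2) = a at *
    generalize (n : ZMod 2) = b at *
    revert a b
    decide
  obtain ⟨k, hk⟩ := (ZMod.intCast_zmod_eq_zero_iff_dvd m 2).1 h3.1
  obtain ⟨l, hl⟩ := (ZMod.intCast_zmod_eq_zero_iff_dvd n 2).1 h3.2
  exact ⟨k + l * d.w, by rw [hk, hl]; push_cast; ring⟩

lemma r_dvd_of_five_dvd_nrm {x : O} (h : 5 ∣ d.nrm x) : d.r ∣ x := by
  obtain ⟨m, n, rfl⟩ := d.span x
  rw [nrm_coords] at h
  obtain ⟨l, hl⟩ : (5 : ℤ) ∣ 2 * m + n := by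
    have : (5 : ℤ) ∣ (2 * m + n) ^ 2 := by
      have := (h.mul_left 4).add (Dvd.intro (n ^ 2) rfl : (5 : ℤ) ∣ 5 * n ^ 2)
      exact (by ring : 4 * (m ^ 2 + m * n - n ^ 2) + 5 * n ^ 2 = (2 * m + n) ^ 2) ▸ this
    exact (by norm_num : Prime (5 : ℤ)).dvd_of_dvd_pow this
  have hn : n = 5 * l - 2 * m := by linarith
  refine ⟨-m + d.r * l * d.w, ?_⟩
  rw [hn, r]
  push_cast
  linear_combination (-4 * l * d.w : O) * d.w_sq

/-- With `δ = 1` the general bound works from norm `3` on, and norm `2` does not occur. -/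
lemma reducible_neg_one : d.Reducible (-1) := by
  intro A B hA hAu hd
  refine d.exists_reduction B hA (δ := 1) (by simp) (by simp) ?_
  have h0 : d.nrm A ≠ 0 := mt d.nrm_eq_zero.1 hA
  have h1 : (d.nrm A).natAbs ≠ 1 := mt d.isUnit_of_natAbs hAu
  have h2 := d.nrm_mod_four A
  have h3 : 3 ≤ (d.nrm A).natAbs := by omega
  have h4 : (3 : ℝ) ≤ (d.nrm A).natAbs := by exact_mod_cast h3
  have h5 : goldenRatio < 1.62 := by
    have := Real.goldenRatio_sq
    nlinarith [Real.goldenRatio_pos]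
  nlinarith

/-- With `δ = √5` the general bound works from norm `6` on. Norms `2` and `3` do not occur; `4` and
`5` are treated by hand. -/
lemma reducible_r : d.Reducible d.r := by
  intro A B hA hAu hd
  have h0 : d.nrm A ≠ 0 := mt d.nrm_eq_zero.1 hA
  have h1 : (d.nrm A).natAbs ≠ 1 := mt d.isUnit_of_natAbs hAu
  have h2 := d.nrm_mod_four A
  have h3 : (d.nrm A).natAbs ≠ 3 := fun h ↦ d.nrm_eq_three h
  by_cases h4 : (d.nrm A).natAbs = 4
  -- Here `A` is `2` times a unit and `B² ≡ √5 ≡ 1` modulo `2`, so `B` can be shifted to `1`. Then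
  -- `1 - √5 = 2(1 - w)` has absolute norm `4 < 16`.
  · obtain ⟨c, rfl⟩ := d.two_dvd_of_even_nrm (x := A) (by omega)
    have hc : IsUnit c := by
      apply d.isUnit_of_natAbs
      rw [nrm_mul, show d.nrm 2 = 4 by simpa using d.nrm_intCast 2] at h4
      omega
    obtain ⟨c', hc'⟩ := hc.exists_right_inv
    have h5 : (2 : O) ∣ B - 1 := by
      refine d.prime_two.dvd_of_dvd_pow (n := 2) ?_
      obtain ⟨e, he⟩ := hd
      exact ⟨c * e - B + d.w, by unfold r at he; linear_combination he⟩
    obtain ⟨e, he⟩ := h5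
    refine ⟨e * c', ?_⟩
    have : (B - e * c' * (2 * c)) ^ 2 - d.r = 2 * (1 - d.w) := by
      have : B - e * c' * (2 * c) = 1 := by linear_combination he - 2 * e * hc'
      rw [this, r]; ring
    rw [this, nrm_mul, nrm_mul, show d.nrm 2 = 4 by simpa using d.nrm_intCast 2,
      show d.nrm (1 - d.w) = -1 by simpa [sub_eq_add_neg] using d.nrm_coords 1 (-1)]
    have := d.nrm_natAbs_of_isUnit hc
    rw [Int.natAbs_mul, Int.natAbs_mul, this]
    norm_num
  by_cases h5 : (d.nrm A).natAbs = 5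
  -- Here `A` is `√5` times a unit and divides `B² - √5`, so `B` can be shifted to `0`, leaving
  -- `-√5` of absolute norm `5 < 25`.
  · obtain ⟨c, rfl⟩ := d.r_dvd_of_five_dvd_nrm (x := A) (by omega)
    have hc : IsUnit c := by
      apply d.isUnit_of_natAbs
      rw [nrm_mul, nrm_r] at h5
      omega
    obtain ⟨c', hc'⟩ := hc.exists_right_inv
    obtain ⟨e, he⟩ : d.r ∣ B := by
      refine d.prime_r.dvd_of_dvd_pow (n := 2) ?_
      obtain ⟨e, he⟩ := hd
      exact ⟨c * e + 1, by linear_combination he⟩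
    refine ⟨e * c', ?_⟩
    have : (B - e * c' * (d.r * c)) ^ 2 - d.r = (-1 : ℤ) * d.r := by
      have : B - e * c' * (d.r * c) = 0 := by linear_combination he - d.r * e * hc'
      rw [this]; push_cast; ring
    rw [this, h5, nrm_mul, nrm_intCast, nrm_r]
    norm_num
  have h6 : 6 ≤ (d.nrm A).natAbs := by omega
  have h7 : (6 : ℝ) ≤ (d.nrm A).natAbs := by exact_mod_cast h6
  have h8 : goldenRatio < 1.62 := by
    have := Real.goldenRatio_sq
    nlinarith [Real.goldenRatio_pos]
  have h9 : √5 < 2.24 := by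
    rw [Real.sqrt_lt' (by norm_num)]; norm_num
  refine d.exists_reduction B hA (δ := √5) ?_ ?_ ?_
  · rw [φ_r, abs_of_nonneg (by positivity)]
  · rw [ψ_r, abs_neg, abs_of_nonneg (by positivity)]
  rw [Real.sq_sqrt (by norm_num)]
  have h10 : √5 * goldenRatio ≤ 2.24 * 1.62 := by
    have := Real.goldenRatio_pos
    gcongr
  have h11 := mul_le_mul_of_nonneg_right h10 (by positivity : (0 : ℝ) ≤ (d.nrm A).natAbs)
  nlinarith

end GoldenData

end QuadRep

end

/-! ### Principal ideals and norms in `O[√D]` -/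

noncomputable section

namespace QuadRep

open Real (goldenRatio goldenConj)
open scoped QuadraticAlgebra

namespace GoldenData

variable {O : Type*} [CommRing O] (d : GoldenData O) {D : O}

/-! The quadratic extension `O[√D]`. -/

-- Since `ψ D < 0`, the norm form is positive definite under `ψ`.
include d in
lemma norm_quadratic_eq_zero (hD : d.ψ D < 0) {z : QuadraticAlgebra O D 0}
    (h : z.norm = 0) : z = 0 := by
  rw [QuadraticAlgebra.norm_def] at h
  have h1 := congrArg d.ψ h
  simp only [zero_mul, add_zero, map_sub, map_mul, map_zero] at h1
  have h2 : d.ψ z.re ^ 2 = 0 := by nlinarith [sq_nonneg (d.ψ z.re), sq_nonneg (d.ψ z.im)]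
  have h3 : d.ψ z.im ^ 2 = 0 := by nlinarith [sq_nonneg (d.ψ z.re), sq_nonneg (d.ψ z.im)]
  ext
  · exact (map_eq_zero_iff _ d.ψ_injective).1 (pow_eq_zero_iff two_ne_zero |>.1 h2)
  · exact (map_eq_zero_iff _ d.ψ_injective).1 (pow_eq_zero_iff two_ne_zero |>.1 h3)

include d in
lemma isDomain_quadratic (hD : d.ψ D < 0) : IsDomain (QuadraticAlgebra O D 0) := by
  have := d.isDomain
  have : NoZeroDivisors (QuadraticAlgebra O D 0) := ⟨fun {a b} hab ↦ by
    have h := congrArg QuadraticAlgebra.norm hab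
    rw [map_mul, QuadraticAlgebra.norm_zero, mul_eq_zero] at h
    exact h.imp (d.norm_quadratic_eq_zero hD) (d.norm_quadratic_eq_zero hD)⟩
  exact NoZeroDivisors.to_isDomain _

end GoldenData

lemma isPrincipal_of_span_mul {S : Type*} [CommRing S] [IsDomain S] {a b : S} {I : Ideal S}
    (ha : a ≠ 0) (h : Ideal.span {a} * I = Ideal.span {b}) : I.IsPrincipal := by
  obtain ⟨i, hi, hi'⟩ : ∃ i ∈ I, a * i = b :=
    Ideal.mem_span_singleton_mul.1 (h ▸ Ideal.mem_span_singleton_self b)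
  refine ⟨i, le_antisymm (fun x hx ↦ ?_) ((Ideal.span_singleton_le_iff_mem I).2 hi)⟩
  have h1 : a * x ∈ Ideal.span {b} := h ▸ Ideal.mul_mem_mul (Ideal.mem_span_singleton_self a) hx
  obtain ⟨s, hs⟩ := Ideal.mem_span_singleton'.1 h1
  refine Ideal.mem_span_singleton'.2 ⟨s, mul_left_cancel₀ ha ?_⟩
  rw [← hs, ← hi']; ring

namespace GoldenData

variable {O : Type*} [CommRing O] (d : GoldenData O) {D : O}

/-- Induction on the norm of `A`. After shifting `B` to `B'`, write `D - B'² = AC` with `C` of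
smaller norm than `A`. Then `(-B' + √D)(A, B' + √D) = A (C, -B' + √D)`, so principality of the
smaller ideal passes to the larger one. -/
lemma isPrincipal_form (hD : d.ψ D < 0) (hred : d.Reducible D) (n : ℕ) :
    ∀ A B : O, (d.nrm A).natAbs = n → A ≠ 0 → A ∣ B ^ 2 - D →
      (Ideal.span {algebraMap O (QuadraticAlgebra O D 0) A, ⟨B, 1⟩}).IsPrincipal := by
  have := d.isDomain
  have := d.isDomain_quadratic hD
  induction n using Nat.strong_induction_on with
  | _ n ih =>
  intro A B hn hA hd
  by_cases hAu : IsUnit A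
  · rw [Ideal.eq_top_of_isUnit_mem _ (Ideal.subset_span (Set.mem_insert _ _))
      (hAu.map (algebraMap O (QuadraticAlgebra O D 0)))]
    exact inferInstance
  obtain ⟨t, ht⟩ := hred A B hA hAu hd
  set B' := B - t * A with hB'
  obtain ⟨C, hC⟩ : A ∣ D - B' ^ 2 := by
    obtain ⟨e, he⟩ := hd
    exact ⟨-(e - 2 * t * B + t ^ 2 * A), by rw [hB']; linear_combination -he⟩
  have hC0 : C ≠ 0 := by
    rintro rfl
    have h1 := congrArg d.ψ hC
    simp only [map_sub, map_pow, mul_zero, map_zero] at h1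
    nlinarith [sq_nonneg (d.ψ B')]
  have hlt : (d.nrm C).natAbs < n := by
    rw [← nrm_neg, neg_sub, hC, nrm_mul, Int.natAbs_mul, sq, hn] at ht
    exact lt_of_mul_lt_mul_left ht (Nat.zero_le _)
  obtain ⟨g, hg⟩ := ih _ hlt C (-B') rfl hC0 ⟨-A, by linear_combination -hC⟩
  rw [Ideal.submodule_span_eq] at hg
  refine isPrincipal_of_span_mul (a := (⟨-B', 1⟩ : QuadraticAlgebra O D 0))
    (b := algebraMap _ _ A * g) (fun h ↦ ?_) ?_
  · have := congrArg QuadraticAlgebra.im h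
    simp at this
  · rw [← Ideal.span_singleton_mul_span_singleton, ← hg]
    have hspan : Ideal.span {algebraMap O (QuadraticAlgebra O D 0) A, ⟨B, 1⟩} =
        Ideal.span {algebraMap O (QuadraticAlgebra O D 0) A, ⟨B', 1⟩} := by
      have : (⟨B, 1⟩ : QuadraticAlgebra O D 0) =
          ⟨B', 1⟩ + algebraMap _ _ A * algebraMap _ _ t := by
        ext <;> simp [hB']; ring
      rw [this, Ideal.span_pair_add_left_mul]
    rw [hspan, Ideal.span_mul_span', Ideal.span_mul_span', Set.singleton_mul, Set.singleton_mul,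
      Set.image_pair, Set.image_pair, Set.pair_comm]
    congr 2
    · ext
      · simp
        linear_combination hC
      · simp
    · simp [mul_comm]

/-- Every nonzero ideal has the shape `h (A, B + √D)` with `A ∣ B² - D`: `h` generates the ideal of
`√D`-coordinates, which also contains all the other coordinates because the ideal is stable under
`√D`. -/
lemma isPrincipalIdealRing_quadratic (hD : d.ψ D < 0) (hred : d.Reducible D) :
    IsPrincipalIdealRing (QuadraticAlgebra O D 0) := by
  have := d.isDomain
  have := d.isDomain_quadratic hD
  have := d.isPrincipalIdealRing
  refine ⟨fun I ↦ ?_⟩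
  by_cases hI : I = ⊥
  · subst hI; exact ⟨0, by simp⟩
  obtain ⟨z, hz, hz0⟩ := Submodule.exists_mem_ne_zero_of_ne_bot hI
  set ι := algebraMap O (QuadraticAlgebra O D 0)
  obtain ⟨h, hh⟩ := (IsPrincipalIdealRing.principal
    (Submodule.map (QuadraticAlgebra.imₗ (R := O) (a := D) (b := 0)) (I.restrictScalars O)))
  obtain ⟨a, ha⟩ := (IsPrincipalIdealRing.principal (I.comap ι))
  rw [Ideal.submodule_span_eq] at hh ha
  have him : ∀ x ∈ I, h ∣ x.im := fun x hx ↦ by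
    have : x.im ∈ Submodule.map (QuadraticAlgebra.imₗ (R := O) (a := D) (b := 0))
      (I.restrictScalars O) := ⟨x, hx, rfl⟩
    rw [hh] at this
    exact Ideal.mem_span_singleton.1 this
  have hre : ∀ x ∈ I, h ∣ x.re := fun x hx ↦ by
    have := him _ (I.mul_mem_left (⟨0, 1⟩ : QuadraticAlgebra O D 0) hx)
    simpa using this
  obtain ⟨z₀, hz₀, hz₀h⟩ : h ∈ Submodule.map (QuadraticAlgebra.imₗ (R := O) (a := D) (b := 0))
      (I.restrictScalars O) := by
    rw [hh]; exact Ideal.mem_span_singleton_self h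
  replace hz₀ : z₀ ∈ I := hz₀
  replace hz₀h : z₀.im = h := hz₀h
  have haI : ι a ∈ I := Ideal.mem_comap.1 (ha ▸ Ideal.mem_span_singleton_self a)
  have hmem : ∀ x : O, ι x ∈ I → a ∣ x := fun x hx ↦
    Ideal.mem_span_singleton.1 (ha ▸ Ideal.mem_comap.2 hx)
  have ha0 : a ≠ 0 := by
    rintro rfl
    have h1 : ι z.norm ∈ I := by
      rw [QuadraticAlgebra.algebraMap_norm_eq_mul_star]; exact I.mul_mem_right _ hz
    exact hz0 (d.norm_quadratic_eq_zero hD (zero_dvd_iff.1 (hmem _ h1)))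
  obtain ⟨A, hA⟩ : h ∣ a := hre _ haI
  obtain ⟨B, hB⟩ : h ∣ z₀.re := hre _ hz₀
  have hz₀' : z₀ = ι h * ⟨B, 1⟩ := by
    ext <;> simp [ι, hB, hz₀h]
  have hh0 : h ≠ 0 := by rintro rfl; simp at hA; exact ha0 hA
  have hA0 : A ≠ 0 := by rintro rfl; simp at hA; exact ha0 hA
  have hdvd : A ∣ B ^ 2 - D := by
    have h1 : ι (h * (B ^ 2 - D)) ∈ I := by
      have : ι (h * (B ^ 2 - D)) = z₀ * ⟨B, -1⟩ := by
        rw [hz₀']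
        ext <;> simp only [ι, QuadraticAlgebra.algebraMap_re, QuadraticAlgebra.algebraMap_im] <;>
          simp
        ring
      rw [this]; exact I.mul_mem_right _ hz₀
    have h2 := hmem _ h1
    rw [hA] at h2
    exact (mul_dvd_mul_iff_left hh0).1 h2
  obtain ⟨g, hg⟩ := d.isPrincipal_form hD hred _ A B rfl hA0 hdvd
  rw [Ideal.submodule_span_eq] at hg
  refine ⟨ι h * g, ?_⟩
  rw [Ideal.submodule_span_eq, ← Ideal.span_singleton_mul_span_singleton, ← hg,
    Ideal.span_mul_span', Set.singleton_mul, Set.image_pair, ← hz₀', ← map_mul, ← hA]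
  refine le_antisymm (fun x hx ↦ ?_) ?_
  · obtain ⟨c, hc⟩ := him x hx
    have h1 : x - ι c * z₀ ∈ I := I.sub_mem hx (I.mul_mem_left _ hz₀)
    have h2 : x - ι c * z₀ = ι (x.re - c * z₀.re) := by
      ext <;> simp [ι, hc, hz₀h]; ring
    rw [h2] at h1
    obtain ⟨e, he⟩ := hmem _ h1
    rw [he] at h2
    refine Ideal.mem_span_pair.2 ⟨ι e, ι c, ?_⟩
    rw [← map_mul, mul_comm e a, ← h2]; ring
  · rw [Ideal.span_le]
    rintro x (rfl | rfl)
    · exact haI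
    · exact hz₀

/-- A prime modulo which `D` is a square is, up to a unit, a norm from `O[√D]`. -/
lemma exists_eq_mul_norm (hD : d.ψ D < 0) (hred : d.Reducible D) {l s : O} (hl : Prime l)
    (hs : l ∣ s ^ 2 - D) : ∃ ε x y : O, IsUnit ε ∧ l = ε * (x ^ 2 - D * y ^ 2) := by
  have := d.isDomain
  have := d.isDomain_quadratic hD
  obtain ⟨g, hg⟩ := d.isPrincipal_form hD hred _ l s rfl hl.ne_zero hs
  rw [Ideal.submodule_span_eq] at hg
  set ι := algebraMap O (QuadraticAlgebra O D 0)
  obtain ⟨μ, hμ⟩ : g ∣ ι l := Ideal.mem_span_singleton.1 (hg ▸ Ideal.subset_span (by simp))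
  obtain ⟨ν, hν⟩ : g ∣ ⟨s, 1⟩ := Ideal.mem_span_singleton.1 (hg ▸ Ideal.subset_span (by simp))
  obtain ⟨p, q, hpq⟩ := Ideal.mem_span_pair.1 (hg ▸ Ideal.mem_span_singleton_self g)
  have h1 : l ∣ g.norm := by
    obtain ⟨e, he⟩ := hs
    rw [← QuadraticAlgebra.algebraMap_dvd_iff_dvd (a := D) (b := 0),
      QuadraticAlgebra.algebraMap_norm_eq_mul_star, ← hpq]
    have h2 : (⟨s, 1⟩ : QuadraticAlgebra O D 0) * star ⟨s, 1⟩ = ι l * ι e := by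
      rw [← map_mul, ← he]
      ext <;> simp only [ι, QuadraticAlgebra.algebraMap_re, QuadraticAlgebra.algebraMap_im] <;>
        simp
      ring
    refine ⟨p * star p * ι l + p * star q * star ⟨s, 1⟩ + q * star p * ⟨s, 1⟩ + q * star q * ι e, ?_⟩
    have h3 : star (ι l) = ι l := by ext <;> simp [ι]
    simp only [star_add, star_mul', h3]
    linear_combination (q * star q) * h2
  have h4 : g.norm * μ.norm = l ^ 2 := by
    rw [← map_mul, ← hμ, QuadraticAlgebra.norm_algebraMap]
  obtain ⟨e, he⟩ := h1
  have h5 : e * μ.norm = l := by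
    refine mul_left_cancel₀ hl.ne_zero ?_
    rw [← mul_assoc, ← he, h4, sq]
  rcases hl.irreducible.isUnit_or_isUnit h5.symm with h6 | h6
  · obtain ⟨ε, hε⟩ := h6.exists_left_inv
    refine ⟨ε, g.re, g.im, .of_mul_eq_one e hε, ?_⟩
    have : g.norm = g.re ^ 2 - D * g.im ^ 2 := by
      rw [QuadraticAlgebra.norm_def]; ring
    rw [← this, he]
    linear_combination (-l) * hε
  -- Otherwise `g` is associated to `l`, so `l` divides `s + √D`, whose second coordinate is `1`.
  · exfalso
    obtain ⟨ε, hε⟩ := (QuadraticAlgebra.isUnit_iff_norm_isUnit.2 h6).exists_right_inv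
    have h7 : ι l ∣ ⟨s, 1⟩ := ⟨ε * ν, by rw [hν, hμ]; linear_combination (-g * ν) * hε⟩
    have h8 := (QuadraticAlgebra.algebraMap_dvd_iff.1 h7).2
    exact hl.not_dvd_one h8

end GoldenData

end QuadRep

end

/-! ### The form `w (√5 b² - a²)`: congruences, and a descent to `O[√-r]` -/

noncomputable section

namespace QuadRep

namespace GoldenData

variable {O : Type*} [CommRing O] (d : GoldenData O)

/-- `l` is of the form `w (√5 b² - a²)`. -/
def Rep (l : O) : Prop := ∃ a b : O, l = d.w * (d.r * b ^ 2 - a ^ 2)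

/-- The congruence modulo `2` determines `a + b`; the one modulo `4` leaves two classes for `b`,
namely `w`, as wanted, and `1`, which a unit of relative norm `1` carries to `w`. -/
lemma exists_rep_mod_two {l a b : O} (h : l = d.w * (d.r * b ^ 2 - a ^ 2)) (h4 : (4 : O) ∣ l + 1) :
    ∃ a' b' : O, l = d.w * (d.r * b' ^ 2 - a' ^ 2) ∧ (2 : O) ∣ a' ∧ (2 : O) ∣ b' - d.w := by
  have := d.isDomain
  have hsq := d.w_sq
  have hunit : ∀ x : O, IsUnit x → ¬ (2 : O) ∣ x := fun x ↦ d.not_two_dvd_of_isUnit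
  have hw := hunit _ d.isUnit_w
  obtain ⟨f, hf⟩ := h4
  -- Modulo `2` one has `√5 ≡ 1`, so the hypothesis reads `w (a + b)² ≡ 1` in `𝔽₄`, whose only
  -- solution is `a + b ≡ w`.
  obtain ⟨e, he⟩ : (2 : O) ∣ a + b - d.w := by
    have h1 : (2 : O) ∣ d.w * (a + b) ^ 2 - 1 :=
      ⟨d.w * a * b + d.w ^ 2 * b ^ 2 - 2 * f, by unfold r at h; linear_combination h - hf⟩
    obtain ⟨g, hg⟩ := h1
    rcases d.mod_two (a + b) with ⟨c, hc⟩ | ⟨c, hc⟩ | h | ⟨c, hc⟩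
    · refine absurd ?_ (hunit 1 isUnit_one)
      exact ⟨d.w * (a + b) * c - g, by linear_combination d.w * (a + b) * hc - hg⟩
    · refine absurd ?_ (hunit (d.w - 1) (.of_mul_eq_one d.w (by linear_combination hsq)))
      exact ⟨g - d.w * (a + b + 1) * c, by linear_combination hg - d.w * (a + b + 1) * hc⟩
    · exact h
    · refine absurd ?_ hw
      refine ⟨g - d.w * (a + b + d.w + 1) * c - 2 * d.w - 1, ?_⟩
      linear_combination hg - d.w * (a + b + d.w + 1) * hc - (d.w + 3) * hsq
  -- Substituting `a = w - b + 2e` and using the hypothesis modulo `4` gives a quadratic in `b` over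
  -- `𝔽₄` with roots `1` and `w`.
  have key : (2 : O) ∣ b ^ 2 + (d.w + 1) * b - d.w := by
    have h1 : (2 : O) * 2 ∣ 2 * (b ^ 2 + (d.w + 1) * b - d.w) := by
      refine ⟨f + d.w * e ^ 2 + d.w ^ 2 * e - d.w * b * e, ?_⟩
      obtain rfl : a = d.w - b + 2 * e := by linear_combination he
      unfold r at h
      linear_combination hf - h + (-2 * b ^ 2 - 2 * b + d.w + 1) * hsq
    exact (mul_dvd_mul_iff_left d.prime_two.ne_zero).1 h1
  obtain ⟨g, hg⟩ := key
  rcases d.mod_two b with ⟨c, rfl⟩ | ⟨c, hc⟩ | h' | ⟨c, hc⟩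
  · refine absurd ?_ hw
    exact ⟨2 * c ^ 2 + (d.w + 1) * c - g, by linear_combination -hg⟩
  -- The coordinates of `(a + b√r)(w² + w√r)`; the second factor has relative norm `w⁴ - r w² = 1`.
  · refine ⟨a * d.w ^ 2 + b * d.w * d.r, a * d.w + b * d.w ^ 2, ?_, ?_, ?_⟩
    · rw [h]; unfold r
      have h1 : d.w ^ 4 - (2 * d.w - 1) * d.w ^ 2 = 1 := by
        linear_combination (d.w ^ 2 - d.w + 1) * hsq
      linear_combination (a ^ 2 * d.w - d.w * (2 * d.w - 1) * b ^ 2) * h1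
    · obtain rfl : b = 1 + 2 * c := by linear_combination hc
      obtain rfl : a = d.w - (1 + 2 * c) + 2 * e := by linear_combination he
      refine ⟨d.w ^ 2 * (e - c) + c * d.w * d.r + d.w ^ 2, ?_⟩
      unfold r
      linear_combination d.w * hsq
    · obtain rfl : b = 1 + 2 * c := by linear_combination hc
      obtain rfl : a = d.w - (1 + 2 * c) + 2 * e := by linear_combination he
      refine ⟨d.w * (e - c) + c * d.w ^ 2 + 1, ?_⟩
      linear_combination 2 * hsq
  · obtain ⟨c, hc⟩ := h'
    exact ⟨a, b, h, ⟨e - c, by linear_combination he - hc⟩, ⟨c, hc⟩⟩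
  · refine absurd ?_ hw
    refine ⟨c * (b + d.w + 1) + (d.w + 1) * c + d.w ^ 2 + 2 * d.w + 1 - g, ?_⟩
    linear_combination -hg + (b + d.w + 1) * hc + (d.w + 1) * hc

variable {d}

include d in
lemma exists_inverse_mod {l b : O} (hl : Prime l) (hb : ¬ l ∣ b) : ∃ p, l ∣ p * b - 1 := by
  have := d.isDomain
  have := d.isPrincipalIdealRing
  obtain ⟨p, q, h⟩ := (hl.irreducible.coprime_iff_not_dvd.2 hb)
  exact ⟨q, -p, by linear_combination h⟩

/-- Modulo `l` the representation reads `r b² ≡ a²`. Here `b` is invertible: otherwise `l` divides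
`a` as well, and `l²` divides `l`. -/
lemma Rep.exists_sq_mod {l : O} (hl : Prime l) (h : d.Rep l) : ∃ t, l ∣ t ^ 2 - d.r := by
  have := d.isDomain
  obtain ⟨a, b, h⟩ := h
  have hw : d.w * (d.w - 1) = 1 := by linear_combination d.w_sq
  have hb : ¬ l ∣ b := by
    rintro ⟨b', hb'⟩
    have h1 : l ∣ a := by
      refine hl.dvd_of_dvd_pow (n := 2) ⟨d.r * l * b' ^ 2 - (d.w - 1), ?_⟩
      rw [hb'] at h
      linear_combination (d.w - 1) * h + (d.r * l ^ 2 * b' ^ 2 - a ^ 2) * hw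
    obtain ⟨a', ha'⟩ := h1
    refine hl.not_dvd_one ⟨d.w * (d.r * b' ^ 2 - a' ^ 2), mul_left_cancel₀ hl.ne_zero ?_⟩
    rw [ha', hb'] at h
    linear_combination h
  obtain ⟨p, q, hp⟩ := exists_inverse_mod (d := d) hl hb
  refine ⟨p * a, d.r * q * (p * b + 1) - p ^ 2 * (d.w - 1), ?_⟩
  linear_combination d.r * (p * b + 1) * hp + p ^ 2 * (d.w - 1) * h +
    p ^ 2 * (d.r * b ^ 2 - a ^ 2) * hw

/-- Both `r` and `-r` are nonzero squares modulo `l`; their quotient is `-1`. -/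
lemma exists_sq_neg_one_mod {l : O} (hl : Prime l) (hr : ¬ l ∣ d.r) (h : d.Rep l)
    (h' : d.conj.Rep l) : ∃ s, l ∣ s ^ 2 + 1 := by
  obtain ⟨t, t₁, ht⟩ := h.exists_sq_mod hl
  obtain ⟨t', t₂, ht'⟩ := h'.exists_sq_mod hl
  rw [conj_r, sub_neg_eq_add] at ht'
  have h1 : ¬ l ∣ t' := by
    rintro ⟨c, hc⟩
    exact hr ⟨t₂ - t' * c, by linear_combination ht' - t' * hc⟩
  obtain ⟨p, q, hp⟩ := exists_inverse_mod (d := d) hl h1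
  exact ⟨p * t, p ^ 2 * t₁ + p ^ 2 * t₂ - q * (p * t' + 1), by
    linear_combination p ^ 2 * ht + p ^ 2 * ht' - (p * t' + 1) * hp⟩

/-- An element of the form `w (√5 b² - a²)` is not a square modulo `√5`. -/
lemma Rep.not_sq_mod_r {l x : O} (hr : ¬ d.r ∣ l) (h : d.Rep l) : ¬ d.r ∣ x ^ 2 - l := by
  rintro ⟨f, hf⟩
  obtain ⟨a, b, h⟩ := h
  obtain ⟨c, hc⟩ := d.r_dvd_w_sub_three
  -- `l ≡ 2 a²`
  have h5 := d.r_sq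
  have h1 : d.r ∣ x ^ 2 - 2 * a ^ 2 :=
    ⟨f + d.w * b ^ 2 - c * a ^ 2 - d.r * a ^ 2, by
      linear_combination hf + h - a ^ 2 * hc + a ^ 2 * h5⟩
  have h2 := d.r_dvd_of_sq_sub_two_sq h1
  refine hr (h ▸ ((dvd_sub (dvd_mul_right _ _) (h2.trans (dvd_pow_self _ two_ne_zero))).mul_left _))

include d in
lemma exists_sq_mul_of_mul_sq {l s T N : O} (hl : Prime l) (hN : N ≠ 0)
    (h : T * N ^ 2 = l * s ^ 2) : ∃ v, T = l * v ^ 2 := by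
  have := d.isDomain
  have := d.isPrincipalIdealRing
  obtain ⟨W, hW⟩ : N ∣ l * s := by
    have : N ^ 2 ∣ (l * s) ^ 2 := ⟨l * T, by linear_combination -l * h⟩
    exact (IsIntegrallyClosed.pow_dvd_pow_iff two_ne_zero).1 this
  have h1 : l * T = W ^ 2 := by
    refine mul_right_cancel₀ (pow_ne_zero 2 hN) ?_
    linear_combination l * h + (l * s + N * W) * hW
  obtain ⟨v, rfl⟩ : l ∣ W := hl.dvd_of_dvd_pow (n := 2) ⟨T, h1.symm⟩
  exact ⟨v, mul_left_cancel₀ hl.ne_zero (by linear_combination h1)⟩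

/-- From `4 ∣ a² + r b²`, reduction modulo `2` gives `a ≡ b`. Since `1 + r = 2w`, the next order
then forces `2 ∣ w b²`. -/
lemma two_dvd_of_four_dvd_norm {z : QuadraticAlgebra O (-d.r) 0} (h : (4 : O) ∣ z.norm) :
    2 ∣ z := by
  have := d.isDomain
  obtain ⟨f, hf⟩ := h
  obtain ⟨a, b⟩ := z
  rw [QuadraticAlgebra.norm_def] at hf
  simp only [zero_mul, add_zero] at hf
  unfold r at hf
  obtain ⟨e, he⟩ : (2 : O) ∣ a + b := by
    refine d.prime_two.dvd_of_dvd_pow (n := 2) ⟨2 * f + a * b + b ^ 2 - d.w * b ^ 2, ?_⟩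
    linear_combination hf
  obtain ⟨g, rfl⟩ : (2 : O) ∣ b := by
    have h1 : (2 : O) * 2 ∣ 2 * (d.w * b ^ 2) :=
      ⟨f + b * e - e ^ 2, by
        obtain rfl : a = 2 * e - b := by linear_combination he
        linear_combination hf⟩
    have h2 := (mul_dvd_mul_iff_left d.prime_two.ne_zero).1 h1
    exact d.prime_two.dvd_of_dvd_pow
      ((d.prime_two.dvd_or_dvd h2).resolve_left (d.not_two_dvd_of_isUnit d.isUnit_w))
  refine ⟨⟨e - g, g⟩, ?_⟩
  ext
  · simp [QuadraticAlgebra.re_ofNat, QuadraticAlgebra.im_ofNat]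
    linear_combination he
  · simp [QuadraticAlgebra.re_ofNat, QuadraticAlgebra.im_ofNat]

/-- If `l` is a norm from both `O[i]` and `O[√√5]`, then up to a power of `1 + i` and a unit it is
a norm from the compositum of the two. -/
lemma exists_sq_add_sq_norm {l c e x y : O} (hl : Prime l) (h1 : l = c ^ 2 - d.r * e ^ 2)
    (h2 : l = x ^ 2 + y ^ 2) : ∃ (j k : QuadraticAlgebra O (-d.r) 0) (a : ℕ) (η : O), a ≤ 2 ∧
      IsUnit η ∧ (j ^ 2 + k ^ 2).norm = l * (η * 2 ^ a) ^ 2 ∧ 2 ^ a ∣ j ^ 2 + k ^ 2 := by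
  have := d.isDomain
  have hneg : d.conj.ψ (-d.r) < 0 := by
    rw [← conj_r, ψ_r]; simp
  have := d.conj.isDomain_quadratic hneg
  have := d.conj.isPrincipalIdealRing_quadratic hneg (d.conj_r ▸ d.conj.reducible_r)
  -- The sign of `x` is free. If both choices failed, `c = x = 0` and the prime `l` would be the
  -- square `y²`.
  wlog hs0 : c + x ≠ 0 generalizing x
  · refine this (x := -x) (by rw [h2]; ring) fun h ↦ ?_
    have hc : c = 0 := by
      have : (2 : O) * c = 0 := by linear_combination not_not.1 hs0 + h
      exact (mul_eq_zero.1 this).resolve_left d.prime_two.ne_zero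
    have hx : x = 0 := by linear_combination not_not.1 hs0 - hc
    have h3 : l = y ^ 2 := by rw [h2, hx]; ring
    exact hl.irreducible.not_isSquare ⟨y, by rw [h3, sq]⟩
  set ι := algebraMap O (QuadraticAlgebra O (-d.r) 0)
  set s := c + x with hs
  set z : QuadraticAlgebra O (-d.r) 0 := ⟨y, e⟩ with hz
  have hss : s * (c - x) = y ^ 2 + d.r * e ^ 2 := by rw [hs]; linear_combination h2 - h1
  have hzz : ι s * ι (c - x) = z * star z := by
    rw [← map_mul, hss]
    ext <;> simp only [ι, hz, QuadraticAlgebra.algebraMap_re, QuadraticAlgebra.algebraMap_im] <;>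
      simp <;> ring
  have hιs : ι s ≠ 0 := (map_ne_zero_iff _ QuadraticAlgebra.algebraMap_injective).2 hs0
  -- With `s = c + x` and `z = y + e√-r` one has `s (c - x) = z z̄`. For `j` a gcd of `s` and `z`,
  -- this refines to `s = jm`, `z = jn`, `z̄ = mk`.
  obtain ⟨j, hj⟩ := IsPrincipalIdealRing.principal (Ideal.span {ι s, z})
  rw [Ideal.submodule_span_eq] at hj
  obtain ⟨m, hm⟩ : j ∣ ι s := Ideal.mem_span_singleton.1 (hj ▸ Ideal.subset_span (by simp))
  obtain ⟨n, hn⟩ : j ∣ z := Ideal.mem_span_singleton.1 (hj ▸ Ideal.subset_span (by simp))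
  obtain ⟨p, q, hpq⟩ := Ideal.mem_span_pair.1 (hj ▸ Ideal.mem_span_singleton_self j)
  have hj0 : j ≠ 0 := by rintro rfl; exact hιs (by rw [hm, zero_mul])
  have hm0 : m ≠ 0 := by rintro rfl; exact hιs (by rw [hm, mul_zero])
  have hbez : p * m + q * n = 1 := mul_left_cancel₀ hj0 (by
    linear_combination hpq - p * hm - q * hn)
  have hmn : m * ι (c - x) = n * star z := mul_left_cancel₀ hj0 (by
    linear_combination hzz - ι (c - x) * hm + star z * hn)
  set k := p * star z + q * ι (c - x) with hk
  have hmk : m * k = star z := by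
    rw [hk]; linear_combination q * hmn + star z * hbez
  -- Expanding with `z z̄ = s (c - x)`, the norm is `s²` times `s² + (c - x)² + z² + z̄² = 2(c² - r
  -- e²) + 2(x² + y²) = 4l`.
  have hnorm : (ι s ^ 2 + z ^ 2).norm = l * (2 * s) ^ 2 := by
    have : ι s ^ 2 + z ^ 2 = ⟨s ^ 2 + y ^ 2 - d.r * e ^ 2, 2 * y * e⟩ := by
      rw [sq, sq, sq, ← map_mul]
      ext <;> simp only [ι, hz, QuadraticAlgebra.re_add, QuadraticAlgebra.im_add,
        QuadraticAlgebra.algebraMap_re, QuadraticAlgebra.algebraMap_im] <;> simp <;> ring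
    rw [this, QuadraticAlgebra.norm_def]
    simp only
    have e1 : (s - (c - x)) ^ 2 = 4 * x ^ 2 := by rw [hs]; ring
    have e2 : (s + (c - x)) ^ 2 = 4 * c ^ 2 := by rw [hs]; ring
    linear_combination (-(y ^ 2 + d.r * e ^ 2) - s * (c - x)) * hss +
      (-2 * s ^ 2) * h1 + (-2 * s ^ 2) * h2
  have hnorm' : (ι s ^ 2 + star z ^ 2).norm = l * (2 * s) ^ 2 := by
    rw [← hnorm, ← QuadraticAlgebra.norm_star]
    have : star (ι s) = ι s := by ext <;> simp [ι]
    rw [star_add, star_pow, star_pow, star_star, this]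
  have hT1 : (j ^ 2 + k ^ 2).norm * m.norm ^ 2 = l * (2 * s) ^ 2 := by
    rw [← hnorm', ← map_pow, ← map_mul, ← hmk, hm]
    congr 1; ring
  have hT2 : (m ^ 2 + n ^ 2).norm * j.norm ^ 2 = l * (2 * s) ^ 2 := by
    rw [← hnorm, ← map_pow, ← map_mul, hm, hn]
    congr 1; ring
  have hjm : j.norm * m.norm = s ^ 2 := by
    rw [← map_mul, ← hm, QuadraticAlgebra.norm_algebraMap]
  have hmN : m.norm ≠ 0 := fun h ↦ hm0 (d.conj.norm_quadratic_eq_zero hneg h)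
  have hjN : j.norm ≠ 0 := fun h ↦ hj0 (d.conj.norm_quadratic_eq_zero hneg h)
  obtain ⟨v, hv⟩ := exists_sq_mul_of_mul_sq (d := d) hl hmN hT1
  obtain ⟨v', hv'⟩ := exists_sq_mul_of_mul_sq (d := d) hl hjN hT2
  -- `j² + k²` and `m² + n²` have norms `l v²` and `l v'²`. Multiplying the two identities and
  -- cancelling `N(j) N(m) = s²` bounds `v` by a divisor of `4`.
  have hvv : (v * v') ^ 2 = (2 ^ 2) ^ 2 := by
    rw [hv] at hT1
    rw [hv'] at hT2
    refine mul_left_cancel₀ (mul_ne_zero (pow_ne_zero 2 hl.ne_zero) (pow_ne_zero 4 hs0)) ?_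
    linear_combination l * (v' ^ 2 * j.norm ^ 2) * hT1 + l * (2 * s) ^ 2 * hT2 -
      l ^ 2 * v ^ 2 * v' ^ 2 * (j.norm * m.norm + s ^ 2) * hjm
  have hv4 : v ∣ 2 ^ 2 := by
    rcases sq_eq_sq_iff_eq_or_eq_neg.1 hvv with h | h
    · exact ⟨v', h.symm⟩
    · exact ⟨-v', by linear_combination h⟩
  obtain ⟨a, ha, hva⟩ := (dvd_prime_pow d.prime_two 2).1 hv4
  obtain ⟨η, hη⟩ := hva.symm
  have hfin : (j ^ 2 + k ^ 2).norm = l * (η * 2 ^ a) ^ 2 := by rw [hv, ← hη]; ring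
  refine ⟨j, k, a, η, ha, η.isUnit, hfin, ?_⟩
  have hnat : ∀ u : QuadraticAlgebra O (-d.r) 0, (2 * u).norm = 4 * u.norm := fun u ↦ by
    rw [map_mul]
    have := QuadraticAlgebra.norm_natCast (R := O) (a := -d.r) (b := 0) 2
    push_cast at this
    rw [this]; norm_num
  -- The norm of `j² + k²` is divisible by `4ᵃ`, and each factor `4` of the norm allows one division
  -- by `2`.
  interval_cases a
  · simp
  · rw [pow_one] at hfin ⊢
    exact two_dvd_of_four_dvd_norm ⟨l * η ^ 2, by rw [hfin]; ring⟩
  · obtain ⟨u, hu⟩ := two_dvd_of_four_dvd_norm (z := j ^ 2 + k ^ 2)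
      ⟨l * η ^ 2 * 4, by rw [hfin]; ring⟩
    rw [hu, hnat] at hfin
    have h4 : u.norm = 4 * (l * η ^ 2) := by
      have h40 : (4 : O) ≠ 0 := by
        have := pow_ne_zero 2 d.prime_two.ne_zero
        norm_num at this; exact this
      exact mul_left_cancel₀ h40 (by rw [hfin]; ring)
    obtain ⟨u', hu'⟩ := two_dvd_of_four_dvd_norm (z := u) ⟨_, h4⟩
    exact ⟨u', by rw [hu, hu']; ring⟩

end GoldenData

end QuadRep

end

/-! ### The field `F₀`: real embeddings and ring of integers -/

noncomputable section

namespace QuadRep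

open IntermediateField Polynomial

lemma eps_isIntegral : IsIntegral ℚ (zeta + zeta⁻¹) := Algebra.IsIntegral.isIntegral _

lemma eps_root : (zeta + zeta⁻¹) ^ 2 + (zeta + zeta⁻¹) - 1 = 0 := by
  have h := congrArg (algebraMap F₀ F) eps₀_sq
  rw [← coe_eps₀]
  exact h

lemma minpoly_eps : minpoly ℚ (zeta + zeta⁻¹) = X ^ 2 + X - 1 := by
  have hdeg : (X ^ 2 + X - 1 : ℚ[X]).natDegree = 2 := by compute_degree!
  have hmonic : (X ^ 2 + X - 1 : ℚ[X]).Monic := by monicity!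
  refine (minpoly.eq_of_irreducible_of_monic ?_ ?_ hmonic).symm
  · rw [hmonic.irreducible_iff_roots_eq_zero_of_degree_le_three (by omega) (by omega)]
    refine Multiset.eq_zero_of_forall_notMem fun q hq ↦ ?_
    have h := isRoot_of_mem_roots hq
    simp only [IsRoot.def, eval_sub, eval_add, eval_pow, eval_X, eval_one] at h
    have h5 : Irrational (√(5 : ℕ)) := Nat.Prime.irrational_sqrt (by norm_num)
    refine h5 ⟨|2 * q + 1|, ?_⟩
    rw [Rat.cast_abs, ← Real.sqrt_sq_eq_abs]
    congr 1
    have : ((2 * q + 1) ^ 2 : ℚ) = 5 := by linear_combination 4 * h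
    exact_mod_cast this
  · simpa using eps_root

/-- The real embedding of `F₀` attached to a real root of `X² + X - 1`. -/
def embOfRoot (x : ℝ) (hx : x ^ 2 + x - 1 = 0) : F₀ →ₐ[ℚ] ℝ :=
  (algHomAdjoinIntegralEquiv ℚ eps_isIntegral).symm ⟨x, by
    rw [mem_aroots, minpoly_eps]
    refine ⟨fun h ↦ ?_, by simpa using hx⟩
    have := congrArg (coeff · 2) h
    simp [coeff_X, coeff_one] at this⟩

lemma embOfRoot_eps (x : ℝ) (hx : x ^ 2 + x - 1 = 0) : embOfRoot x hx eps₀ = x :=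
  algHomAdjoinIntegralEquiv_symm_apply_gen ℚ eps_isIntegral _

/-- The embedding of `F₀` with `u ↦ (1 + √5) / 2`. -/
def emb₁ : F₀ →ₐ[ℚ] ℝ := embOfRoot (Real.goldenRatio - 1) (by
  linear_combination Real.goldenRatio_sq)

/-- The embedding of `F₀` with `u ↦ (1 - √5) / 2`. -/
def emb₂ : F₀ →ₐ[ℚ] ℝ := embOfRoot (Real.goldenConj - 1) (by
  linear_combination Real.goldenConj_sq)

lemma u_eq : u = eps₀ + 1 := by unfold u sqrt5; ring

lemma emb₁_u : emb₁ u = Real.goldenRatio := by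
  rw [u_eq, map_add, map_one, emb₁, embOfRoot_eps]; ring

lemma emb₂_u : emb₂ u = Real.goldenConj := by
  rw [u_eq, map_add, map_one, emb₂, embOfRoot_eps]; ring

lemma u_sq : u ^ 2 = u + 1 := by rw [u_eq]; linear_combination eps₀_sq

lemma exists_rat_coords (x : F₀) : ∃ p q : ℚ, x = p + q * u := by
  obtain ⟨x, hx⟩ := x
  have hx' : x ∈ Algebra.adjoin ℚ {zeta + zeta⁻¹} := by
    rw [← adjoin_simple_toSubalgebra_of_isAlgebraic eps_isIntegral.isAlgebraic]; exact hx
  have hu : (u : F) = zeta + zeta⁻¹ + 1 :=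
    (congrArg (algebraMap F₀ F) u_eq).trans (congrArg (· + 1) coe_eps₀)
  suffices ∃ p q : ℚ, x = p + q * (u : F) by
    obtain ⟨p, q, h⟩ := this
    exact ⟨p, q, Subtype.ext (h.trans (by simp))⟩
  have hu2 : (u : F) ^ 2 = u + 1 := congrArg (algebraMap F₀ F) u_sq
  clear hx
  induction hx' using Algebra.adjoin_induction with
  | mem x hx => exact ⟨-1, 1, by rw [Set.mem_singleton_iff.1 hx, hu]; push_cast; ring⟩
  | algebraMap r => exact ⟨r, 0, by simp⟩
  | add x y _ _ hx hy =>
    obtain ⟨p, q, rfl⟩ := hx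
    obtain ⟨p', q', rfl⟩ := hy
    exact ⟨p + p', q + q', by push_cast; ring⟩
  | mul x y _ _ hx hy =>
    obtain ⟨p, q, rfl⟩ := hx
    obtain ⟨p', q', rfl⟩ := hy
    exact ⟨p * p' + q * q', p * q' + q * p' + q * q', by
      push_cast; linear_combination (q * q' : F) * hu2⟩

lemma exists_int_of_isIntegral {p : ℚ} (h : IsIntegral ℤ (p : ℝ)) : ∃ n : ℤ, p = n := by
  have h1 : IsIntegral ℤ p :=
    (isIntegral_algebraMap_iff (algebraMap ℚ ℝ).injective).1 (by simpa using h)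
  obtain ⟨n, hn⟩ := IsIntegrallyClosed.isIntegral_iff.1 h1
  exact ⟨n, by simpa using hn.symm⟩

/-- For `x = p + q u` the trace `s = 2p + q` and the norm `t` are integers, and `(5q)² = 5(s² -
4t)`. So `5q` is an integer divisible by `5`, and parity then makes `p` an integer. -/
lemma exists_int_coords {x : F₀} (hx : IsIntegral ℤ x) : ∃ m n : ℤ, x = m + n * u := by
  obtain ⟨p, q, rfl⟩ := exists_rat_coords x
  have h1 : IsIntegral ℤ (emb₁ (p + q * u)) := hx.map (emb₁.restrictScalars ℤ)
  have h2 : IsIntegral ℤ (emb₂ (p + q * u)) := hx.map (emb₂.restrictScalars ℤ)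
  simp only [map_add, map_mul, map_ratCast, emb₁_u] at h1
  simp only [map_add, map_mul, map_ratCast, emb₂_u] at h2
  obtain ⟨s, hs⟩ := exists_int_of_isIntegral (p := 2 * p + q) (by
    convert! h1.add h2 using 1
    push_cast; linear_combination (-q : ℝ) * Real.goldenRatio_add_goldenConj)
  obtain ⟨t, ht⟩ := exists_int_of_isIntegral (p := p ^ 2 + p * q - q ^ 2) (by
    convert! h1.mul h2 using 1
    push_cast; linear_combination (-p * q : ℝ) * Real.goldenRatio_add_goldenConj -
      (q ^ 2 : ℝ) * Real.goldenRatio_mul_goldenConj)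
  have h5 : (5 * q) ^ 2 = ((5 * (s ^ 2 - 4 * t) : ℤ) : ℚ) := by
    push_cast; rw [← hs, ← ht]; ring
  obtain ⟨k, hk⟩ : ∃ k : ℤ, 5 * q = k := by
    have : IsIntegral ℤ ((5 * q) ^ 2) := h5 ▸ isIntegral_algebraMap
    obtain ⟨n, hn⟩ := IsIntegrallyClosed.isIntegral_iff.1 (IsIntegral.of_pow two_pos this)
    exact ⟨n, by simpa using hn.symm⟩
  rw [hk] at h5
  have h6 : k ^ 2 = 5 * (s ^ 2 - 4 * t) := by exact_mod_cast h5
  obtain ⟨n, rfl⟩ : (5 : ℤ) ∣ k := (by norm_num : Prime (5 : ℤ)).dvd_of_dvd_pow ⟨_, h6⟩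
  have hq : q = n := by
    push_cast at hk; linarith
  have h7 : (s - n) * (s + n) = 4 * (n ^ 2 + t) := by linarith
  obtain ⟨m, hm⟩ : (2 : ℤ) ∣ s - n := by
    rcases Int.even_or_odd (s - n) with h | h
    · exact h.two_dvd
    · exfalso
      have h8 : Odd (s + n) := by
        have : s + n = s - n + 2 * n := by ring
        rw [this]; exact h.add_even (even_two_mul n)
      have h9 := h.mul h8
      rw [h7, Int.odd_iff] at h9
      omega
  refine ⟨m, n, ?_⟩
  have hp : p = m := by
    have : (s : ℚ) - n = 2 * m := by exact_mod_cast hm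
    rw [← hq, ← hs] at this; linarith
  rw [hp, hq]; simp

/-- The ring of integers of `F₀` as `ℤ[u]`. -/
def goldenF₀ : GoldenData (𝓞 F₀) where
  w := uInt
  w_sq := RingOfIntegers.ext (by simpa [coe_uInt] using u_sq)
  span x := by
    obtain ⟨m, n, h⟩ := exists_int_coords x.isIntegral_coe
    exact ⟨m, n, RingOfIntegers.ext (by simpa [coe_uInt] using h)⟩
  φ := emb₁.toRingHom.comp (algebraMap (𝓞 F₀) F₀)
  ψ := emb₂.toRingHom.comp (algebraMap (𝓞 F₀) F₀)
  φ_w := emb₁_u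
  ψ_w := emb₂_u

lemma goldenF₀_r : goldenF₀.r = sqrt5Int := rfl

lemma goldenF₀_conj_w : goldenF₀.conj.w = uConjInt := rfl

/-! The matrices in terms of the integral coordinates. -/

lemma isIntegral_coe_iff {x : F₀} : IsIntegral ℤ (x : F) ↔ IsIntegral ℤ x :=
  isIntegral_algebraMap_iff (A := F₀) (B := F) (algebraMap F₀ F).injective

/-- If `ρ d² ` is integral with `ρ = √5` times a unit, then `d` is integral. -/
lemma isIntegral_of_sqrt5_mul_sq {b : F₀} (h : IsIntegral ℤ (sqrt5 * b ^ 2)) : IsIntegral ℤ b := by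
  obtain ⟨c, hc⟩ : ∃ c : 𝓞 F₀, (c : F₀) = sqrt5 * b ^ 2 := ⟨⟨_, h⟩, rfl⟩
  have h1 : IsIntegral ℤ (sqrt5 * b) := by
    refine IsIntegral.of_pow two_pos ?_
    have : (sqrt5 * b) ^ 2 = ((sqrt5Int * c : 𝓞 F₀) : F₀) := by
      simp only [map_mul, coe_sqrt5Int, hc]; ring
    rw [this]; exact RingOfIntegers.isIntegral_coe _
  obtain ⟨e, he⟩ : ∃ e : 𝓞 F₀, (e : F₀) = sqrt5 * b := ⟨⟨_, h1⟩, rfl⟩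
  -- `(√5 b)²` is `√5` times an integral element, so the prime `√5` divides `√5 b`.
  obtain ⟨f, rfl⟩ : sqrt5Int ∣ e := by
    refine goldenF₀.prime_r.dvd_of_dvd_pow (n := 2) ⟨c, RingOfIntegers.ext ?_⟩
    simp only [map_pow, map_mul, goldenF₀_r, coe_sqrt5Int, hc, he]; ring
  simp only [map_mul, coe_sqrt5Int] at he
  have h5 : sqrt5 ≠ 0 := fun h ↦ by have := sqrt5_sq; rw [h] at this; norm_num at this
  rw [← mul_left_cancel₀ h5 he]
  exact RingOfIntegers.isIntegral_coe _

end QuadRep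

end

/-! ### From integral similitude matrices to the form -/

noncomputable section

namespace QuadRep

open Matrix

lemma complexConj_zeta : IsCMField.complexConj F zeta = zeta⁻¹ := by
  obtain ⟨f⟩ : Nonempty (F →+* ℂ) := inferInstance
  apply f.injective
  rw [IsCMField.complexEmbedding_complexConj, map_inv₀]
  exact (Complex.inv_eq_conj ((zeta_spec.map_of_injective f.injective).norm'_eq_one
    (by norm_num))).symm

lemma complexConj_coe (x : F₀) : IsCMField.complexConj F (x : F) = x := by
  obtain ⟨p, q, rfl⟩ := exists_rat_coords x
  have hu : (u : F) = zeta + zeta⁻¹ + 1 :=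
    (congrArg (algebraMap F₀ F) u_eq).trans (congrArg (· + 1) coe_eps₀)
  have h : ((p + q * u : F₀) : F) = p + q * (u : F) := by simp
  rw [h, hu]
  simp only [map_add, map_mul, map_ratCast, map_one, map_inv₀, complexConj_zeta, inv_inv]
  ring

lemma complexConj_alpha (n : ℕ) :
    IsCMField.complexConj F (alpha (zeta ^ n)) = -alpha (zeta ^ n) := by
  simp only [alpha, map_sub, map_inv₀, map_pow, complexConj_zeta, inv_pow, inv_inv]
  ring

lemma isIntegral_alpha {z : F} (h : z ^ 5 = 1) : IsIntegral ℤ (alpha z) := by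
  have h0 : z ≠ 0 := by rintro rfl; norm_num at h
  have hz : IsIntegral ℤ z := IsIntegral.of_pow (n := 5) (by norm_num) (h ▸ isIntegral_one)
  have : z⁻¹ = z ^ 4 := inv_eq_of_mul_eq_one_right (by rw [← h]; ring)
  rw [alpha, this]
  exact hz.sub (hz.pow 4)

/-- In the coordinates `2x` and `y + v x`, with `v = ε⁻¹`, the denominators of the matrices
disappear. -/
lemma smul_gamma_eq {z : F} {v : F₀} (hv : eps z * v = 1) (x y : F₀) :
    (x : F) • gammaQ z + (y : F) • gammaP z =
      !![-(alpha z * ((y + v * x : F₀) : F)), ((2 * x : F₀) : F);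
        (v : F) * ((2 * x : F₀) : F), alpha z * ((y + v * x : F₀) : F)] := by
  have h : (eps z)⁻¹ = v := inv_eq_of_mul_eq_one_right hv
  ext i j
  fin_cases i <;> fin_cases j <;>
    simp only [gammaQ, gammaP, div_eq_mul_inv, h] <;> simp <;> push_cast [coe_two] <;> ring

/-- The similitude condition costs nothing: `α` is purely imaginary and `F₀` is fixed by
conjugation, so the identity holds with the determinant as multiplier. Only integrality is a
constraint. -/
lemma mem_GU₂_of_integral {z : F} (hz5 : z ^ 5 = 1) {v c : F₀} (hv : eps z * v = 1)
    (hv' : IsIntegral ℤ v) (hα : IsCMField.complexConj F (alpha z) = -alpha z) {x y : F₀}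
    (hx : IsIntegral ℤ (2 * x)) (hy : IsIntegral ℤ (y + v * x)) (hc : c ≠ 0)
    (hdet : ((x : F) • gammaQ z + (y : F) • gammaP z).det = c) :
    (x : F) • gammaQ z + (y : F) • gammaP z ∈ GU₂ z := by
  refine ⟨?_, ⟨c, hc, ?_⟩, ?_⟩
  · rw [hdet]
    exact (map_ne_zero_iff (algebraMap F₀ F) (algebraMap F₀ F).injective).2 hc
  · rw [← hdet, smul_gamma_eq hv]
    ext i j
    fin_cases i <;> fin_cases j <;>
      simp [conjTr, hermGram, det_fin_two, Matrix.mul_apply, Fin.sum_univ_two, complexConj_coe, hα]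
    · linear_combination (-(v : F) * ((2 : F₀) * x) ^ 2) * hv
    · linear_combination (-alpha z * (y + v * x) * ((2 : F₀) * x)) * hv
    · linear_combination (alpha z * (y + v * x) * ((2 : F₀) * x)) * hv
    · linear_combination (-((2 : F₀) * (x : F)) ^ 2) * hv
  · rw [smul_gamma_eq hv]
    have hα' := isIntegral_alpha hz5
    rw [← isIntegral_coe_iff] at hx hy hv'
    intro i j
    fin_cases i <;> fin_cases j
    · exact (hα'.mul hy).neg
    · exact hx
    · exact hv'.mul hx
    · exact hα'.mul hy

/-- An off-diagonal entry is `2x`. A diagonal entry is `α (y + v x)`, whose square is `±√5` times a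
unit times `(y + v x)²`; since `√5` is prime, no denominator can hide there. -/
lemma isIntegral_of_mem_GU₂ {z : F} {v ρ : F₀} (hv : eps z * v = 1) (hv' : IsIntegral ℤ v⁻¹)
    (hα : alpha z ^ 2 = ((ρ * v : F₀) : F)) (hρ : ρ = sqrt5 ∨ ρ = -sqrt5) {x y : F₀}
    (h : (x : F) • gammaQ z + (y : F) • gammaP z ∈ GU₂ z) :
    IsIntegral ℤ (2 * x) ∧ IsIntegral ℤ (y + v * x) := by
  obtain ⟨-, -, h⟩ := h
  rw [smul_gamma_eq hv] at h
  have hv0 : v ≠ 0 := by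
    rintro rfl
    simp at hv
  refine ⟨isIntegral_coe_iff.1 (h 0 1), isIntegral_of_sqrt5_mul_sq ?_⟩
  have h1 : IsIntegral ℤ ((alpha z * ((y + v * x : F₀) : F)) ^ 2) := (h 1 1).pow 2
  rw [mul_pow, hα] at h1
  have h2 : IsIntegral ℤ (ρ * v * (y + v * x) ^ 2) := isIntegral_coe_iff.1 (by push_cast at h1 ⊢; exact h1)
  have h3 : IsIntegral ℤ (ρ * (y + v * x) ^ 2) := by
    convert! hv'.mul h2 using 1
    field_simp
  rcases hρ with rfl | rfl
  · exact h3
  · convert! h3.neg using 1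
    ring

lemma u_integer_inv : u⁻¹ = u - 1 := inv_eq_of_mul_eq_one_right (by linear_combination u_sq)

lemma uConj_sq : uConj ^ 2 = uConj + 1 := by
  unfold uConj; linear_combination (1 / 4 : F₀) * sqrt5_sq

lemma uConj_inv : uConj⁻¹ = uConj - 1 := inv_eq_of_mul_eq_one_right (by linear_combination uConj_sq)

lemma isIntegral_uConj : IsIntegral ℤ uConj := coe_uConjInt ▸ uConjInt.isIntegral_coe

lemma coe_u : (u : F) = (1 + (sqrt5 : F)) / 2 := rfl

lemma coe_uConj : (uConj : F) = (1 - (sqrt5 : F)) / 2 := rfl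

lemma eps_mul_u : eps zeta * (u : F) = 1 := by
  have h : (u : F) ≠ 0 := fun h ↦ by
    have h1 : (u : F) ^ 2 = u + 1 := congrArg (algebraMap F₀ F) u_sq
    rw [h] at h1; norm_num at h1
  rw [coe_u, ← eps_inv] at *
  exact mul_inv_cancel₀ (fun h' ↦ h (by rw [h', _root_.inv_zero]))

lemma eps_mul_uConj : eps (zeta ^ 2) * (uConj : F) = 1 := by
  have h : (uConj : F) ≠ 0 := fun h ↦ by
    have h1 : (uConj : F) ^ 2 = uConj + 1 := congrArg (algebraMap F₀ F) uConj_sq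
    rw [h] at h1; norm_num at h1
  rw [coe_uConj, ← eps_sq_inv] at *
  exact mul_inv_cancel₀ (fun h' ↦ h (by rw [h', _root_.inv_zero]))

lemma q_eq (x y : F₀) : q x y = u * (sqrt5 * (y + u * x) ^ 2 - (2 * x) ^ 2) := by
  unfold q
  have h : sqrt5 = 2 * u - 1 := by unfold u; ring
  rw [h]
  linear_combination (-2 * u ^ 2 - u - 3) * x ^ 2 * u_sq

lemma qConj_eq (x y : F₀) :
    qConj x y = uConj * (-sqrt5 * (y + uConj * x) ^ 2 - (2 * x) ^ 2) := by
  unfold qConj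
  have h : sqrt5 = 1 - 2 * uConj := by unfold uConj; ring
  rw [h]
  linear_combination (-2 * uConj ^ 2 - uConj - 3) * x ^ 2 * uConj_sq

lemma representable_iff {lam : 𝓞 F₀} (h0 : lam ≠ 0) :
    Representable lam ↔ goldenF₀.Rep lam := by
  constructor
  · rintro ⟨x, y, hq, h⟩
    obtain ⟨h1, h2⟩ := isIntegral_of_mem_GU₂ eps_mul_u
      (u_integer_inv ▸ u_isIntegral.sub isIntegral_one) (ρ := -sqrt5)
      (by rw [alpha_sq]; push_cast; rw [coe_u]; ring) (.inr rfl) h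
    obtain ⟨a, ha⟩ : ∃ a : 𝓞 F₀, (a : F₀) = 2 * x := ⟨⟨_, h1⟩, rfl⟩
    obtain ⟨b, hb⟩ : ∃ b : 𝓞 F₀, (b : F₀) = y + u * x := ⟨⟨_, h2⟩, rfl⟩
    refine ⟨a, b, RingOfIntegers.ext ?_⟩
    simp only [map_mul, map_sub, map_pow, goldenF₀_r, coe_sqrt5Int, ha, hb]
    rw [← hq, q_eq]; rfl
  · rintro ⟨a, b, h⟩
    have hq : q (a / 2) (b - u * (a / 2)) = lam := by
      have h1 := congrArg (algebraMap (𝓞 F₀) F₀) h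
      simp only [map_mul, map_sub, map_pow, goldenF₀_r, coe_sqrt5Int] at h1
      refine Eq.trans ?_ h1.symm
      rw [q_eq, sub_add_cancel, mul_div_cancel₀ _ (two_ne_zero)]; rfl
    refine ⟨a / 2, b - u * (a / 2), hq, ?_⟩
    refine mem_GU₂_of_integral zeta_pow_five eps_mul_u u_isIntegral
      (by simpa using complexConj_alpha 1) ?_ ?_ (c := lam) ?_ ?_
    · rw [mul_div_cancel₀ _ (two_ne_zero)]; exact a.isIntegral_coe
    · rw [sub_add_cancel]; exact b.isIntegral_coe
    · exact (map_ne_zero_iff _ RingOfIntegers.coe_injective).2 h0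
    · rw [det_eq_q, hq]

lemma representableConj_iff {lam : 𝓞 F₀} (h0 : lam ≠ 0) :
    RepresentableConj lam ↔ goldenF₀.conj.Rep lam := by
  constructor
  · rintro ⟨x, y, hq, h⟩
    obtain ⟨h1, h2⟩ := isIntegral_of_mem_GU₂ eps_mul_uConj
      (uConj_inv ▸ isIntegral_uConj.sub isIntegral_one) (ρ := sqrt5)
      (by rw [alpha_sq_sq]; push_cast; rw [coe_uConj]; ring) (.inl rfl) h
    obtain ⟨a, ha⟩ : ∃ a : 𝓞 F₀, (a : F₀) = 2 * x := ⟨⟨_, h1⟩, rfl⟩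
    obtain ⟨b, hb⟩ : ∃ b : 𝓞 F₀, (b : F₀) = y + uConj * x := ⟨⟨_, h2⟩, rfl⟩
    refine ⟨a, b, RingOfIntegers.ext ?_⟩
    simp only [map_mul, map_sub, map_neg, map_pow, goldenF₀_conj_w, GoldenData.conj_r, goldenF₀_r,
      coe_sqrt5Int, coe_uConjInt, ha, hb]
    rw [← hq, qConj_eq]
  · rintro ⟨a, b, h⟩
    have hq : qConj (a / 2) (b - uConj * (a / 2)) = lam := by
      have h1 := congrArg (algebraMap (𝓞 F₀) F₀) h
      simp only [map_mul, map_sub, map_neg, map_pow, goldenF₀_conj_w, GoldenData.conj_r, goldenF₀_r,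
        coe_sqrt5Int, coe_uConjInt] at h1
      refine Eq.trans ?_ h1.symm
      rw [qConj_eq, sub_add_cancel, mul_div_cancel₀ _ (two_ne_zero)]
    refine ⟨a / 2, b - uConj * (a / 2), hq, ?_⟩
    refine mem_GU₂_of_integral (by rw [← pow_mul, mul_comm, pow_mul, zeta_pow_five, one_pow])
      eps_mul_uConj isIntegral_uConj (complexConj_alpha 2) ?_ ?_ (c := lam) ?_ ?_
    · rw [mul_div_cancel₀ _ (two_ne_zero)]; exact a.isIntegral_coe
    · rw [sub_add_cancel]; exact b.isIntegral_coe
    · exact (map_ne_zero_iff _ RingOfIntegers.coe_injective).2 h0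
    · rw [det_eq_qConj, hq]

end QuadRep

end

/-! ### The biquadratic extension `L / F₀`: Galois action and splitting -/

noncomputable section

namespace QuadRep

open scoped Pointwise

variable {L : Type*} [Field L] [NumberField L] [Algebra F₀ L]

omit [NumberField L] in
lemma coe_gal_smul (g : Gal(L/F₀)) (x : 𝓞 L) : ((g • x : 𝓞 L) : L) = g x :=
  algebraMap.coe_smul' g x L

omit [NumberField L] in
lemma gal_smul_algebraMap (g : Gal(L/F₀)) (a : 𝓞 F₀) :
    g • algebraMap (𝓞 F₀) (𝓞 L) a = algebraMap (𝓞 F₀) (𝓞 L) a := by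
  apply RingOfIntegers.coe_injective
  rw [← RingOfIntegers.coe_eq_algebraMap, coe_gal_smul, RingOfIntegers.coe_eq_algebraMap,
    ← IsScalarTower.algebraMap_apply, IsScalarTower.algebraMap_apply (𝓞 F₀) F₀ L,
    AlgEquiv.commutes]

/-- Generators `i = √-1` and `θ = √(±√5)` of the biquadratic extension `L` of `F₀`, together with
generators of its Galois group. -/
structure BiquadData (d : GoldenData (𝓞 F₀)) (L : Type*) [Field L] [NumberField L]
    [Algebra F₀ L] where
  /-- a square root of `-1` -/
  i : 𝓞 L
  /-- a square root of `±√5` -/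
  θ : 𝓞 L
  i_sq : i ^ 2 = -1
  θ_sq : θ ^ 2 = algebraMap (𝓞 F₀) (𝓞 L) d.r
  /-- the automorphism fixing `θ` -/
  σ : Gal(L/F₀)
  /-- the automorphism fixing `i` -/
  τ : Gal(L/F₀)
  σ_i : σ • i = -i
  σ_θ : σ • θ = θ
  τ_i : τ • i = i
  τ_θ : τ • θ = -θ
  eq_one : ∀ g : Gal(L/F₀), g • i = i → g • θ = θ → g = 1

namespace BiquadData

variable {d : GoldenData (𝓞 F₀)} (D : BiquadData d L)

/-- The same extension, seen from the conjugate generator. -/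
def conj : BiquadData d.conj L where
  i := D.i
  -- `iθ` is a square root of `-r`. Since `σ` negates `i` and `τ` negates `θ`, the automorphism
  -- fixing `iθ` and negating `i` is `στ`.
  θ := D.i * D.θ
  i_sq := D.i_sq
  θ_sq := by
    rw [mul_pow, D.i_sq, D.θ_sq, d.conj_r, map_neg]; ring
  σ := D.σ * D.τ
  τ := D.τ
  σ_i := by rw [mul_smul, D.τ_i, D.σ_i]
  σ_θ := by rw [mul_smul, smul_mul', D.τ_i, D.τ_θ, smul_mul', smul_neg, D.σ_i, D.σ_θ]; ring
  τ_i := D.τ_i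
  τ_θ := by rw [smul_mul', D.τ_i, D.τ_θ]; ring
  eq_one g hi hθ := by
    refine D.eq_one g hi ?_
    rw [smul_mul', hi] at hθ
    have hi0 : D.i ≠ 0 := fun h ↦ by have := D.i_sq; simp [h] at this
    exact mul_left_cancel₀ hi0 hθ

lemma i_ne_zero : D.i ≠ 0 := fun h ↦ by have := D.i_sq; simp [h] at this

lemma isUnit_i : IsUnit D.i := .of_mul_eq_one (-D.i) (by linear_combination -D.i_sq)

lemma θ_ne_zero : D.θ ≠ 0 := fun h ↦ by
  have h1 := D.θ_sq
  rw [h, zero_pow two_ne_zero, eq_comm,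
    map_eq_zero_iff _ (FaithfulSMul.algebraMap_injective (𝓞 F₀) (𝓞 L))] at h1
  exact d.prime_r.ne_zero h1

lemma smul_i (g : Gal(L/F₀)) : g • D.i = D.i ∨ g • D.i = -D.i := by
  rw [← sq_eq_sq_iff_eq_or_eq_neg, ← smul_pow', D.i_sq, smul_neg, smul_one]

lemma smul_θ (g : Gal(L/F₀)) : g • D.θ = D.θ ∨ g • D.θ = -D.θ := by
  rw [← sq_eq_sq_iff_eq_or_eq_neg, ← smul_pow', D.θ_sq, gal_smul_algebraMap]

omit [Algebra F₀ L] in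
lemma ne_neg_self {x : 𝓞 L} (hx : x ≠ 0) : -x ≠ x := fun h ↦ hx (by
  have h1 : (2 : 𝓞 L) * x = 0 := by linear_combination -h
  exact (mul_eq_zero.1 h1).resolve_left two_ne_zero)

lemma eq_of_smul {g h : Gal(L/F₀)} (hi : g • D.i = h • D.i) (hθ : g • D.θ = h • D.θ) : g = h := by
  have := D.eq_one (h⁻¹ * g) (by rw [mul_smul, hi, inv_smul_smul])
    (by rw [mul_smul, hθ, inv_smul_smul])
  exact (inv_mul_eq_one.1 this).symm

lemma univ_eq [DecidableEq Gal(L/F₀)] [Fintype Gal(L/F₀)] :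
    (Finset.univ : Finset Gal(L/F₀)) = {1, D.σ, D.τ, D.σ * D.τ} := by
  refine (Finset.eq_univ_of_forall fun g ↦ ?_).symm
  simp only [Finset.mem_insert, Finset.mem_singleton]
  rcases D.smul_i g with hi | hi <;> rcases D.smul_θ g with hθ | hθ
  · exact .inl (D.eq_one g hi hθ)
  · exact .inr (.inr (.inl (D.eq_of_smul (by rw [hi, D.τ_i]) (by rw [hθ, D.τ_θ]))))
  · exact .inr (.inl (D.eq_of_smul (by rw [hi, D.σ_i]) (by rw [hθ, D.σ_θ])))
  · exact .inr (.inr (.inr (D.eq_of_smul (by rw [hi, mul_smul, D.τ_i, D.σ_i])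
      (by rw [hθ, mul_smul, D.τ_θ, smul_neg, D.σ_θ]))))

lemma σ_mul_σ : D.σ * D.σ = 1 := D.eq_one _ (by rw [mul_smul, D.σ_i, smul_neg, D.σ_i, neg_neg])
  (by rw [mul_smul, D.σ_θ, D.σ_θ])

lemma τ_mul_τ : D.τ * D.τ = 1 := D.eq_one _ (by rw [mul_smul, D.τ_i, D.τ_i])
  (by rw [mul_smul, D.τ_θ, smul_neg, D.τ_θ, neg_neg])

lemma τ_mul_σ : D.τ * D.σ = D.σ * D.τ := D.eq_of_smul
    (by simp only [mul_smul, D.σ_i, D.τ_i, smul_neg]) (by simp only [mul_smul, D.σ_θ, D.τ_θ, smul_neg])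

/-- The norm to `F₀` as a product of conjugates. -/
lemma intNorm_eq [IsGalois F₀ L] (x : 𝓞 L) :
    algebraMap (𝓞 F₀) (𝓞 L) (Algebra.intNorm (𝓞 F₀) (𝓞 L) x) =
      x * D.σ • x * (D.τ • (x * D.σ • x)) := by
  classical
  apply RingOfIntegers.coe_injective
  rw [← IsScalarTower.algebraMap_apply, IsScalarTower.algebraMap_apply (𝓞 F₀) F₀ L,
    Algebra.algebraMap_intNorm (A := 𝓞 F₀) (K := F₀) (L := L) (B := 𝓞 L),
    Algebra.norm_eq_prod_automorphisms, D.univ_eq]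
  have h1 : (1 : Gal(L/F₀)) ≠ D.σ := fun h ↦ ne_neg_self D.i_ne_zero (by
    rw [← D.σ_i, ← h, one_smul])
  have h2 : (1 : Gal(L/F₀)) ≠ D.τ := fun h ↦ ne_neg_self D.θ_ne_zero (by
    rw [← D.τ_θ, ← h, one_smul])
  have h3 : (1 : Gal(L/F₀)) ≠ D.σ * D.τ := fun h ↦ ne_neg_self D.i_ne_zero (by
    conv_rhs => rw [← one_smul Gal(L/F₀) D.i, h, mul_smul, D.τ_i, D.σ_i])
  have h4 : D.σ ≠ D.τ := fun h ↦ ne_neg_self D.i_ne_zero (by rw [← D.σ_i, h, D.τ_i])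
  have h5 : D.σ ≠ D.σ * D.τ := fun h ↦ h2 (by simpa using h : D.τ = 1).symm
  have h6 : D.τ ≠ D.σ * D.τ := fun h ↦ h1 (by simpa using h : D.σ = 1).symm
  rw [Finset.prod_insert (by simp [h1, h2, h3]), Finset.prod_insert (by simp [h4, h5]),
    Finset.prod_insert (by simpa using h6), Finset.prod_singleton, ← D.τ_mul_σ, smul_mul', ← mul_smul]
  simp only [map_mul, ← RingOfIntegers.coe_eq_algebraMap, coe_gal_smul, AlgEquiv.one_apply]
  ring

/-! Splitting. -/

/-- Modulo `P` both `i` and `θ` are congruent to elements of `F₀`, so the decomposition group fixes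
them modulo `P`. As `2`, `i`, `θ` lie outside `P`, no sign change is possible. -/
lemma stabilizer_eq_bot {P : Ideal (𝓞 L)} [P.IsPrime] (h2 : (2 : 𝓞 L) ∉ P) (hr : D.θ ∉ P)
    {s t : 𝓞 F₀} (hs : D.i ^ 2 - algebraMap _ _ s ^ 2 ∈ P)
    (ht : D.θ ^ 2 - algebraMap _ _ t ^ 2 ∈ P) : MulAction.stabilizer Gal(L/F₀) P = ⊥ := by
  rw [eq_bot_iff]
  intro g hg
  have hgP : ∀ x ∈ P, g • x ∈ P := fun x hx ↦ by
    have := Ideal.smul_mem_pointwise_smul g x P hx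
    rwa [MulAction.mem_stabilizer_iff.1 hg] at this
  have key : ∀ (x : 𝓞 L) (a : 𝓞 F₀), x ^ 2 - algebraMap _ _ a ^ 2 ∈ P → g • x - x ∈ P := by
    intro x a h
    have h1 : (x - algebraMap (𝓞 F₀) (𝓞 L) a) * (x + algebraMap (𝓞 F₀) (𝓞 L) a) ∈ P := by
      convert! h using 1; ring
    rcases Ideal.IsPrime.mem_or_mem inferInstance h1 with h | h
    · have h3 := hgP _ h
      rw [smul_sub, gal_smul_algebraMap] at h3
      convert! P.sub_mem h3 h using 1; ring
    · have h3 := hgP _ h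
      rw [smul_add, gal_smul_algebraMap] at h3
      convert! P.sub_mem h3 h using 1; ring
  refine Subgroup.mem_bot.2 (D.eq_one g ?_ ?_)
  · refine (D.smul_i g).resolve_right fun h ↦ ?_
    have h1 := key _ _ hs
    rw [h] at h1
    refine h2 ((Ideal.mul_unit_mem_iff_mem P D.isUnit_i).1 ?_)
    convert! P.neg_mem h1 using 1; ring
  · refine (D.smul_θ g).resolve_right fun h ↦ ?_
    have h1 := key _ _ ht
    rw [h] at h1
    have h3 : (2 : 𝓞 L) * D.θ ∈ P := by
      convert! P.neg_mem h1 using 1; ring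
    exact (Ideal.IsPrime.mem_or_mem inferInstance h3).elim h2 hr

end BiquadData

lemma isMaximal_span {lam : 𝓞 F₀} (h : Prime lam) : (Ideal.span {lam}).IsMaximal :=
  ((Ideal.span_singleton_prime h.ne_zero).2 h).isMaximal (by simpa using h.ne_zero)

omit [NumberField L] in
lemma algebraMap_mem_iff {I : Ideal (𝓞 F₀)} {P : Ideal (𝓞 L)} (hP : P ∈ I.primesOver (𝓞 L))
    {x : 𝓞 F₀} : algebraMap (𝓞 F₀) (𝓞 L) x ∈ P ↔ x ∈ I := by
  have := hP.2
  exact (Ideal.mem_of_liesOver P I x).symm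

/-- The order of the decomposition group is `e f`, and that group is trivial. -/
lemma splitsCompletely [IsGalois F₀ L] {d : GoldenData (𝓞 F₀)} (D : BiquadData d L) {lam s t : 𝓞 F₀}
    (hl : Prime lam) (h2 : ¬ lam ∣ 2) (hr : ¬ lam ∣ d.r) (hs : lam ∣ s ^ 2 + 1)
    (ht : lam ∣ t ^ 2 - d.r) : SplitsCompletely L (Ideal.span {lam}) := by
  intro P hP
  have := isMaximal_span hl
  have := hP.1
  have := hP.2
  have hmem : ∀ {x : 𝓞 F₀}, algebraMap (𝓞 F₀) (𝓞 L) x ∈ P ↔ lam ∣ x := fun {x} ↦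
    (algebraMap_mem_iff hP).trans Ideal.mem_span_singleton
  have hst := D.stabilizer_eq_bot (P := P) (s := s) (t := t)
    (fun h ↦ h2 (hmem.1 (by rw [map_ofNat]; exact h)))
    (fun h ↦ hr (hmem.1 (by rw [← D.θ_sq]; exact P.pow_mem_of_mem h 2 two_pos)))
    (by
      rw [D.i_sq, ← map_pow, ← map_one (algebraMap (𝓞 F₀) (𝓞 L)), ← map_neg, ← map_sub, hmem,
        ← dvd_neg]
      convert! hs using 1; ring)
    (by
      rw [D.θ_sq, ← map_pow, ← map_sub, hmem, ← dvd_neg]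
      convert! ht using 1; ring)
  have : Finite (𝓞 F₀ ⧸ Ideal.span {lam}) :=
    Ideal.finiteQuotientOfFreeOfNeBot _ (by simpa using hl.ne_zero)
  have hcard := Ideal.card_stabilizer_eq (G := Gal(L/F₀)) (Ideal.span {lam}) P
  rw [hst, Subgroup.card_bot,
    Ideal.ramificationIdxIn_eq_ramificationIdx (Ideal.span {lam}) P Gal(L/F₀),
    Ideal.inertiaDegIn_eq_inertiaDeg (Ideal.span {lam}) P Gal(L/F₀)] at hcard
  exact ⟨Nat.eq_one_of_mul_eq_one_right hcard.symm, Nat.eq_one_of_mul_eq_one_left hcard.symm⟩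

omit [NumberField L] in
/-- At a prime of residue degree one every element is congruent to an element of `F₀`. -/
lemma exists_sub_mem {I : Ideal (𝓞 F₀)} [I.IsMaximal] {P : Ideal (𝓞 L)} [P.IsMaximal]
    [P.LiesOver I] (h : P.inertiaDeg (𝓞 F₀) = 1) (x : 𝓞 L) :
    ∃ y : 𝓞 F₀, x - algebraMap _ _ y ∈ P := by
  let : Field (𝓞 F₀ ⧸ I) := Ideal.Quotient.field I
  rw [Ideal.inertiaDeg_eq_of_isMaximal I P] at h
  obtain ⟨y, hy⟩ := (finrank_eq_one_iff_of_nonzero' (1 : 𝓞 L ⧸ P) one_ne_zero).1 h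
    (Ideal.Quotient.mk P x)
  obtain ⟨y, rfl⟩ := Ideal.Quotient.mk_surjective y
  refine ⟨y, Ideal.Quotient.eq.1 ?_⟩
  rw [← hy, Algebra.smul_def, mul_one]
  rfl

end QuadRep

end

/-! ### The splitting field of `t⁴ - 5` as a biquadratic extension; complex conjugations -/

noncomputable section

namespace QuadRep

variable {L : Type*} [Field L] [NumberField L] [Algebra F₀ L]

open Polynomial ComplexConjugate

lemma isGalois_of_isSplittingField [IsSplittingField ℚ L (X ^ 4 - 5)] : IsGalois F₀ L := by
  have h5 : (X ^ 4 - 5 : ℚ[X]) = X ^ 4 - C 5 := by rw [map_ofNat]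
  have : IsGalois ℚ L := by
    refine IsGalois.of_separable_splitting_field (p := (X ^ 4 - 5 : ℚ[X])) ?_
    rw [h5]
    exact separable_X_pow_sub_C _ (by norm_num) (by norm_num)
  exact IsGalois.tower_top_of_isGalois ℚ F₀ L

omit [NumberField L] in
/-- Complex conjugation with respect to an embedding extending a real embedding of `F₀`. -/
lemma exists_complex_conj [IsGalois F₀ L] (φ : F₀ →+* ℝ) :
    ∃ (Φ : L →+* ℂ) (g : Gal(L/F₀)), (∀ a : F₀, Φ (algebraMap F₀ L a) = (φ a : ℂ)) ∧
      ∀ x, Φ (g x) = conj (Φ x) := by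
  have : Algebra.IsAlgebraic F₀ L := inferInstance
  let Φ : L →+* ℂ := ComplexEmbedding.lift L (Complex.ofRealHom.comp φ)
  have hΦ : ∀ a : F₀, Φ (algebraMap F₀ L a) = (φ a : ℂ) := fun a ↦
    RingHom.congr_fun (ComplexEmbedding.lift_comp_algebraMap L (Complex.ofRealHom.comp φ)) a
  obtain ⟨g, hg⟩ := ComplexEmbedding.exists_comp_symm_eq_of_comp_eq (k := F₀) Φ
    ((starRingEnd ℂ).comp Φ) (by ext a; simp [hΦ])
  exact ⟨Φ, g.symm, hΦ, fun x ↦ RingHom.congr_fun hg x⟩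

lemma conj_eq_neg_of_sq {z : ℂ} {c : ℝ} (hc : c < 0) (h : z ^ 2 = c) : conj z = -z := by
  have him : z.re * z.im = 0 := by
    have := congrArg Complex.im h; simp [sq] at this; linarith
  have hre : z.re ^ 2 - z.im ^ 2 = c := by
    have := congrArg Complex.re h; simp [sq] at this; linarith
  rcases mul_eq_zero.1 him with h0 | h0
  · apply Complex.ext <;> simp [h0]
  · rw [h0] at hre; nlinarith [sq_nonneg z.re]

lemma conj_eq_of_sq {z : ℂ} {c : ℝ} (hc : 0 < c) (h : z ^ 2 = c) : conj z = z := by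
  have him : z.re * z.im = 0 := by
    have := congrArg Complex.im h; simp [sq] at this; linarith
  have hre : z.re ^ 2 - z.im ^ 2 = c := by
    have := congrArg Complex.re h; simp [sq] at this; linarith
  rcases mul_eq_zero.1 him with h0 | h0
  · rw [h0] at hre; nlinarith [sq_nonneg z.im]
  · apply Complex.ext <;> simp [h0]

/-- `t⁴ - 5 = (t² - √5)(t² + √5)` splits in `L`, and the quotient of a root of the second factor by
a root of the first is a square root of `-1`. -/
lemma exists_sqrt [IsSplittingField ℚ L (X ^ 4 - 5)] :
    ∃ i θ : L, i ^ 2 = -1 ∧ θ ^ 2 = algebraMap F₀ L sqrt5 := by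
  have hs : (algebraMap F₀ L sqrt5) ^ 2 = 5 := by
    rw [← map_pow, sqrt5_sq, map_ofNat]
  set s := algebraMap F₀ L sqrt5
  have hs0 : s ≠ 0 := fun h ↦ by rw [h] at hs; norm_num at hs
  have hsp := IsSplittingField.splits L (X ^ 4 - 5 : ℚ[X])
  have hmap : (X ^ 4 - 5 : ℚ[X]).map (algebraMap ℚ L) = (X ^ 2 - C s) * (X ^ 2 - C (-s)) := by
    simp only [Polynomial.map_sub, Polynomial.map_pow, map_X, Polynomial.map_ofNat, map_neg]
    have h5 : (5 : L[X]) = C s ^ 2 := by rw [← C_pow, hs, map_ofNat]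
    rw [h5]; ring
  have hne : (X ^ 4 - 5 : ℚ[X]).map (algebraMap ℚ L) ≠ 0 := by
    rw [hmap]; exact mul_ne_zero (X_pow_sub_C_ne_zero two_pos _) (X_pow_sub_C_ne_zero two_pos _)
  have root : ∀ c : L, (X ^ 2 - C c) ∣ (X ^ 4 - 5 : ℚ[X]).map (algebraMap ℚ L) →
      ∃ y, y ^ 2 = c := fun c hc ↦ by
    obtain ⟨y, hy⟩ := (hsp.of_dvd hne hc).exists_eval_eq_zero
      (by rw [degree_X_pow_sub_C two_pos]; norm_num)
    exact ⟨y, by simpa [sub_eq_zero] using hy⟩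
  obtain ⟨θ, hθ⟩ := root s (by rw [hmap]; exact dvd_mul_right _ _)
  obtain ⟨y, hy⟩ := root (-s) (by rw [hmap]; exact dvd_mul_left _ _)
  exact ⟨y / θ, θ, by rw [div_pow, hy, hθ, neg_div, div_self hs0], hθ⟩

lemma eq_one_of_smul [IsSplittingField ℚ L (X ^ 4 - 5)] {i θ : L} (hi : i ^ 2 = -1)
    (hθ : θ ^ 2 = algebraMap F₀ L sqrt5) {g : Gal(L/F₀)} (hgi : g i = i) (hgθ : g θ = θ) :
    g = 1 := by
  have hs : (algebraMap F₀ L sqrt5) ^ 2 = 5 := by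
    rw [← map_pow, sqrt5_sq, map_ofNat]
  have key : (g.restrictScalars ℚ : L →ₐ[ℚ] L) = AlgHom.id ℚ L := by
    refine AlgHom.ext_of_adjoin_eq_top (IsSplittingField.adjoin_rootSet L (X ^ 4 - 5 : ℚ[X])) ?_
    intro x hx
    have h4 : x ^ 4 - 5 = 0 := by
      have := aeval_eq_zero_of_mem_rootSet hx
      simpa [map_ofNat] using this
    have h0 : (x - θ) * (x + θ) * ((x - i * θ) * (x + i * θ)) = 0 := by
      linear_combination h4 - (θ ^ 2 * x ^ 2 - θ ^ 4) * hi - hs -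
        (θ ^ 2 + algebraMap F₀ L sqrt5) * hθ
    simp only [mul_eq_zero, sub_eq_zero, add_eq_zero_iff_eq_neg] at h0
    change g x = x
    rcases h0 with (h | h) | (h | h) <;> rw [h] <;> simp [hgi, hgθ]
  ext x
  exact DFunLike.congr_fun key x

lemma goldenF₀_φ_r_pos : 0 < goldenF₀.φ goldenF₀.r := by
  rw [GoldenData.φ_r]; positivity

lemma goldenF₀_ψ_r_neg : goldenF₀.ψ goldenF₀.r < 0 := by
  rw [GoldenData.ψ_r, neg_lt_zero]; positivity

/-- Over the embedding with `√5 > 0`, complex conjugation fixes `θ` and negates `i`, hence is `σ`.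
-/
lemma BiquadData.exists_embedding (D : BiquadData goldenF₀ L) [IsGalois F₀ L] :
    ∃ Φ : 𝓞 L →+* ℂ, (∀ a, Φ (algebraMap (𝓞 F₀) (𝓞 L) a) = (goldenF₀.φ a : ℂ)) ∧
      ∀ x, Φ (D.σ • x) = conj (Φ x) := by
  obtain ⟨Φ, g, hΦ, hg⟩ := exists_complex_conj (L := L) (emb₁ : F₀ →+* ℝ)
  have hΦ' : ∀ a : 𝓞 F₀, Φ (algebraMap (𝓞 F₀) (𝓞 L) a : 𝓞 L) = (goldenF₀.φ a : ℂ) := fun a ↦ hΦ a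
  have hgx : ∀ x : 𝓞 L, Φ ((g • x : 𝓞 L) : L) = conj (Φ x) := fun x ↦ by
    rw [coe_gal_smul]; exact hg _
  have hinj : Function.Injective fun x : 𝓞 L ↦ Φ x :=
    Φ.injective.comp RingOfIntegers.coe_injective
  have hgσ : g = D.σ := by
    refine D.eq_of_smul ?_ ?_
    · rw [D.σ_i]
      apply hinj
      change Φ ((g • D.i : 𝓞 L) : L) = _
      rw [hgx, conj_eq_neg_of_sq (c := -1) (by norm_num)]
      · simp
      · simp [← map_pow, D.i_sq]
    · rw [D.σ_θ]
      apply hinj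
      change Φ ((g • D.θ : 𝓞 L) : L) = _
      rw [hgx, conj_eq_of_sq goldenF₀_φ_r_pos]
      rw [← hΦ', ← D.θ_sq]; simp
  exact ⟨Φ.comp (algebraMap (𝓞 L) L), hΦ', fun x ↦ hgσ ▸ hgx x⟩

/-- The automorphisms come from complex conjugations, so no degree has to be computed. Over `emb₁`
conjugation fixes `θ` and negates `i`; over `emb₂` it negates both. The product of the two is `τ`.
-/
lemma nonempty_biquadData [IsSplittingField ℚ L (X ^ 4 - 5)] :
    Nonempty (BiquadData goldenF₀ L) := by
  have := isGalois_of_isSplittingField (L := L)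
  obtain ⟨i₀, θ₀, hi₀, hθ₀⟩ := exists_sqrt (L := L)
  obtain ⟨i, rfl⟩ : ∃ i : 𝓞 L, (i : L) = i₀ :=
    ⟨⟨i₀, .of_pow two_pos (by rw [hi₀]; exact isIntegral_one.neg)⟩, rfl⟩
  obtain ⟨θ, rfl⟩ : ∃ θ : 𝓞 L, (θ : L) = θ₀ :=
    ⟨⟨θ₀, .of_pow two_pos (by
      rw [hθ₀, ← coe_sqrt5Int]
      exact (RingOfIntegers.isIntegral_coe _).algebraMap)⟩, rfl⟩
  have hi : i ^ 2 = -1 := by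
    apply RingOfIntegers.coe_injective; simpa using hi₀
  have hθ : θ ^ 2 = algebraMap (𝓞 F₀) (𝓞 L) goldenF₀.r := by
    apply RingOfIntegers.coe_injective
    simp only [map_pow]
    rw [hθ₀, goldenF₀_r, ← coe_sqrt5Int]; rfl
  have aut : ∀ φ : F₀ →+* ℝ, ∃ g : Gal(L/F₀), g • i = -i ∧
      (0 < φ goldenF₀.r → g • θ = θ) ∧ (φ goldenF₀.r < 0 → g • θ = -θ) := fun φ ↦ by
    obtain ⟨Φ, g, hΦ, hg⟩ := exists_complex_conj (L := L) φ
    have hgx : ∀ x : 𝓞 L, Φ ((g • x : 𝓞 L) : L) = conj (Φ x) := fun x ↦ by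
      rw [coe_gal_smul]; exact hg _
    have hinj : Function.Injective fun x : 𝓞 L ↦ Φ x :=
      Φ.injective.comp RingOfIntegers.coe_injective
    have hθ' : Φ θ ^ 2 = (φ goldenF₀.r : ℂ) := by
      rw [← hΦ, ← map_pow, hθ₀, goldenF₀_r, coe_sqrt5Int]
    refine ⟨g, hinj ?_, fun h ↦ hinj ?_, fun h ↦ hinj ?_⟩
    · change Φ ((g • i : 𝓞 L) : L) = _
      rw [hgx, conj_eq_neg_of_sq (c := -1) (by norm_num)]
      · simp
      · rw [← map_pow, hi₀]; simp
    · exact (hgx θ).trans (conj_eq_of_sq h hθ')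
    · exact (hgx θ).trans ((conj_eq_neg_of_sq h hθ').trans (by simp))
  obtain ⟨σ, hσi, hσθ, -⟩ := aut emb₁
  obtain ⟨σ', hσi', -, hσθ'⟩ := aut emb₂
  have hσθ := hσθ goldenF₀_φ_r_pos
  have hσθ' := hσθ' goldenF₀_ψ_r_neg
  refine ⟨⟨i, θ, hi, hθ, σ, σ * σ', hσi, hσθ, ?_, ?_, fun g hgi hgθ ↦ ?_⟩⟩
  · rw [mul_smul, hσi', smul_neg, hσi, neg_neg]
  · rw [mul_smul, hσθ', smul_neg, hσθ]
  · exact eq_one_of_smul hi₀ hθ₀ (by rw [← coe_gal_smul, hgi]) (by rw [← coe_gal_smul, hgθ])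

end QuadRep

end

/-! ### Positivity of norms from `L`, and non-principality -/

noncomputable section

namespace QuadRep

variable {L : Type*} [Field L] [NumberField L] [Algebra F₀ L]

open ComplexConjugate

namespace BiquadData

variable {d : GoldenData (𝓞 F₀)} (D : BiquadData d L)

lemma exists_algebraMap_eq [IsGalois F₀ L] {x : 𝓞 L} (hσ : D.σ • x = x) (hτ : D.τ • x = x) :
    ∃ a, algebraMap (𝓞 F₀) (𝓞 L) a = x := by
  classical
  refine Algebra.IsInvariant.isInvariant (G := Gal(L/F₀)) x fun g ↦ ?_
  have hg := Finset.mem_univ g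
  simp only [D.univ_eq, Finset.mem_insert, Finset.mem_singleton] at hg
  rcases hg with rfl | rfl | rfl | rfl
  · exact one_smul _ x
  · exact hσ
  · exact hτ
  · rw [mul_smul, hτ, hσ]

include D in
/-- Norms from `L` are, up to a factor `4`, norms from `F₀(θ)`. -/
lemma exists_four_mul_intNorm [IsGalois F₀ L] (x : 𝓞 L) :
    ∃ a e : 𝓞 F₀, 4 * Algebra.intNorm (𝓞 F₀) (𝓞 L) x = a ^ 2 - d.r * e ^ 2 := by
  have hinj := FaithfulSMul.algebraMap_injective (𝓞 F₀) (𝓞 L)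
  have hN := D.intNorm_eq x
  set N := Algebra.intNorm (𝓞 F₀) (𝓞 L) x
  set α := x * D.σ • x with hα
  have hσα : D.σ • α = α := by
    rw [hα, smul_mul', ← mul_smul, D.σ_mul_σ, one_smul, mul_comm]
  have hστα : D.σ • D.τ • α = D.τ • α := by rw [← mul_smul, ← D.τ_mul_σ, mul_smul, hσα]
  have hττα : D.τ • D.τ • α = α := by rw [← mul_smul, D.τ_mul_τ, one_smul]
  obtain ⟨a, ha⟩ := D.exists_algebraMap_eq (x := α + D.τ • α) (by rw [smul_add, hσα, hστα])
    (by rw [smul_add, hττα, add_comm])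
  obtain ⟨e, he⟩ := D.exists_algebraMap_eq (x := D.θ * (α - D.τ • α))
    (by rw [smul_mul', D.σ_θ, smul_sub, hσα, hστα])
    (by rw [smul_mul', D.τ_θ, smul_sub, hττα]; ring)
  have h1 : e ^ 2 = d.r * (a ^ 2 - 4 * N) := by
    apply hinj
    simp only [map_pow, map_mul, map_sub, map_ofNat, ← D.θ_sq, ha, he, hN]
    ring
  obtain ⟨e, rfl⟩ := d.prime_r.dvd_of_dvd_pow (Dvd.intro _ h1.symm)
  refine ⟨a, e, mul_left_cancel₀ d.prime_r.ne_zero ?_⟩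
  linear_combination h1

/-- As `σ` is complex conjugation over `φ`, the norm becomes `|x|² |τx|²`. -/
lemma φ_intNorm_nonneg (D : BiquadData goldenF₀ L) [IsGalois F₀ L] (x : 𝓞 L) :
    0 ≤ goldenF₀.φ (Algebra.intNorm (𝓞 F₀) (𝓞 L) x) := by
  obtain ⟨Φ, hΦ, hσ⟩ := D.exists_embedding
  have h := congrArg Φ (D.intNorm_eq x)
  rw [hΦ, smul_mul', ← mul_smul, D.τ_mul_σ, mul_smul, map_mul, map_mul, map_mul, hσ, hσ,
    Complex.mul_conj, Complex.mul_conj] at h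
  have h' : goldenF₀.φ (Algebra.intNorm (𝓞 F₀) (𝓞 L) x) =
    Complex.normSq (Φ x) * Complex.normSq (Φ (D.τ • x)) := by exact_mod_cast h
  rw [h']
  exact mul_nonneg (Complex.normSq_nonneg _) (Complex.normSq_nonneg _)

end BiquadData

lemma relNorm_eq_self {I : Ideal (𝓞 F₀)} [I.IsMaximal] {P : Ideal (𝓞 L)}
    (hP : P ∈ I.primesOver (𝓞 L)) (hf : P.inertiaDeg (𝓞 F₀) = 1) :
    Ideal.relNorm (𝓞 F₀) P = I := by
  have := hP.2
  have : P.IsMaximal := Ideal.isMaximal_of_mem_primesOver hP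
  rw [Ideal.relNorm_eq_pow_of_isMaximal P I, hf, pow_one]

/-- The norm of a generator is totally positive: under `φ` by complex conjugation, under `ψ` because
four times it is `a² - r e²` with `ψ r < 0`. Hence it is `lam η²` with `η` a unit, and `lam` would
be a square modulo `√5`. -/
lemma BiquadData.not_isPrincipal (D : BiquadData goldenF₀ L) [IsGalois F₀ L] {lam : 𝓞 F₀}
    (hl : Prime lam) (hφ : 0 < goldenF₀.φ lam) (hψ : 0 < goldenF₀.ψ lam)
    (hrep : goldenF₀.Rep lam) (hr : ¬ goldenF₀.r ∣ lam) {P : Ideal (𝓞 L)}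
    (hP : P ∈ (Ideal.span {lam}).primesOver (𝓞 L)) (hf : P.inertiaDeg (𝓞 F₀) = 1) :
    ¬ P.IsPrincipal := by
  rintro ⟨π, rfl⟩
  have := isMaximal_span hl
  have h1 := relNorm_eq_self hP hf
  rw [Ideal.submodule_span_eq, Ideal.relNorm_singleton, Ideal.span_singleton_eq_span_singleton]
    at h1
  obtain ⟨a, e, h4⟩ := D.exists_four_mul_intNorm π
  have hN := D.φ_intNorm_nonneg π
  set N := Algebra.intNorm (𝓞 F₀) (𝓞 L) π
  obtain ⟨ε, hε⟩ := h1.symm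
  have hN0 : N ≠ 0 := h1.symm.ne_zero_iff.1 hl.ne_zero
  have hφN : 0 < goldenF₀.φ N :=
    hN.lt_of_ne' ((map_ne_zero_iff _ goldenF₀.φ_injective).2 hN0)
  have hψN : 0 < goldenF₀.ψ N := by
    refine lt_of_le_of_ne ?_ ((map_ne_zero_iff _ goldenF₀.ψ_injective).2 hN0).symm
    have h := congrArg goldenF₀.ψ h4
    simp only [map_mul, map_sub, map_pow, map_ofNat] at h
    nlinarith [goldenF₀_ψ_r_neg, sq_nonneg (goldenF₀.ψ a), sq_nonneg (goldenF₀.ψ e)]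
  rw [← hε, map_mul] at hφN hψN
  obtain ⟨η, hη, hεη⟩ := goldenF₀.unit_eq_sq_of_pos ε.isUnit
    ((mul_pos_iff_of_pos_left hφ).1 hφN) ((mul_pos_iff_of_pos_left hψ).1 hψN)
  obtain ⟨η', hη'⟩ := hη.exists_right_inv
  -- From `4 lam η² = a² - r e²` one gets `(2aη⁻¹)² ≡ 16 lam ≡ lam` modulo `√5`.
  refine hrep.not_sq_mod_r hr (x := 2 * a * η') ?_
  rw [← hε, hεη] at h4
  have h5 := goldenF₀.r_sq
  refine ⟨3 * goldenF₀.r * lam + 4 * η' ^ 2 * e ^ 2, ?_⟩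
  linear_combination -4 * η' ^ 2 * h4 + 16 * lam * (η * η' + 1) * hη' - 3 * lam * h5

end QuadRep

end

/-! ### Constructing norms from `L` -/

noncomputable section

namespace QuadRep

variable {L : Type*} [Field L] [NumberField L] [Algebra F₀ L]

omit [Algebra F₀ L] in
/-- An element `v` whose half is a root of the monic polynomial `t² - s t + p` is divisible by
`2`. -/
lemma exists_two_mul_eq {v s p : 𝓞 L} (h : v ^ 2 - 2 * s * v + 4 * p = 0) : ∃ z, 2 * z = v := by
  have h' : (v : L) ^ 2 - 2 * s * v + 4 * p = 0 := by
    have := congrArg (algebraMap (𝓞 L) L) h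
    simpa [map_ofNat] using this
  have : IsIntegral (𝓞 L) ((v : L) / 2) := by
    refine ⟨.X ^ 2 - .C s * .X + .C p, by monicity!, ?_⟩
    simp only [Polynomial.eval₂_add, Polynomial.eval₂_sub, Polynomial.eval₂_mul,
      Polynomial.eval₂_pow, Polynomial.eval₂_X, Polynomial.eval₂_C]
    linear_combination h' / 4
  obtain ⟨z, hz⟩ := IsIntegrallyClosed.isIntegral_iff.1 this
  refine ⟨z, RingOfIntegers.coe_injective ?_⟩
  rw [map_mul, hz, map_ofNat]
  ring

namespace BiquadData

variable {d : GoldenData (𝓞 F₀)} (D : BiquadData d L)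

/-- The embedding of `𝓞 F₀[√r]` that sends `√r` to `θ`. -/
def ofQuadratic {r : 𝓞 F₀} (hr : d.r = r) : QuadraticAlgebra (𝓞 F₀) r 0 →ₐ[𝓞 F₀] 𝓞 L :=
  QuadraticAlgebra.lift ⟨D.θ, by rw [← sq, D.θ_sq, hr, zero_smul, add_zero, Algebra.smul_def, mul_one]⟩

lemma ofQuadratic_apply {r : 𝓞 F₀} (hr : d.r = r) (z : QuadraticAlgebra (𝓞 F₀) r 0) :
    D.ofQuadratic hr z = algebraMap _ _ z.re + algebraMap _ _ z.im * D.θ := by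
  simp [ofQuadratic, QuadraticAlgebra.lift, Algebra.smul_def]

lemma σ_ofQuadratic {r : 𝓞 F₀} (hr : d.r = r) (z : QuadraticAlgebra (𝓞 F₀) r 0) :
    D.σ • D.ofQuadratic hr z = D.ofQuadratic hr z := by
  simp only [ofQuadratic_apply, smul_add, smul_mul', gal_smul_algebraMap, D.σ_θ]

lemma ofQuadratic_mul_τ {r : 𝓞 F₀} (hr : d.r = r) (z : QuadraticAlgebra (𝓞 F₀) r 0) :
    D.ofQuadratic hr z * D.τ • D.ofQuadratic hr z = algebraMap _ _ z.norm := by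
  simp only [ofQuadratic_apply, smul_add, smul_mul', gal_smul_algebraMap, D.τ_θ,
    QuadraticAlgebra.norm_def, map_add, map_sub, map_mul, ← hr, ← D.θ_sq, map_zero]
  ring

/-- A sum of two squares `j² + k²` in `𝓞 F₀[θ]` divisible by `2ᵃ`, `a ≤ 2`, is `2ᵃ` times a norm
from `L`. -/
lemma exists_mul_σ_eq {J K m : 𝓞 L} (hJ : D.σ • J = J) (hK : D.σ • K = K) {a : ℕ} (ha : a ≤ 2)
    (h : J ^ 2 + K ^ 2 = 2 ^ a * m) : ∃ ρ : 𝓞 L, ρ * D.σ • ρ = m := by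
  have hi := D.i_sq
  have hσ : D.σ • (J + D.i * K) = J - D.i * K := by
    rw [smul_add, smul_mul', hJ, hK, D.σ_i]; ring
  have h2 : D.σ • (2 : 𝓞 L) = 2 := by
    rw [← map_ofNat (algebraMap (𝓞 F₀) (𝓞 L)) 2, gal_smul_algebraMap]
  have hcancel : ∀ {x y : 𝓞 L}, 4 * x = 4 * y → x = y := mul_left_cancel₀ (by norm_num)
  have half : ∀ {v w s : 𝓞 L}, D.σ • v = w → v + w = 2 * s → v * w = 4 * m →
      ∃ ρ : 𝓞 L, ρ * D.σ • ρ = m := by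
    intro v w s hv hs hp
    obtain ⟨z, hz⟩ := exists_two_mul_eq (v := v) (s := s) (p := m)
      (by linear_combination v * hs - hp)
    have hz' : 2 * D.σ • z = w := by rw [← hv, ← hz, smul_mul', h2]
    refine ⟨z, hcancel ?_⟩
    rw [← hp, ← hz, ← hz']; ring
  -- The element `ρ` is `J + iK`, `(J + iK)(1 - i)/2` or `(J + iK)/2` for `a = 0, 1, 2`. In the last
  -- two cases it is integral because its relative trace and norm are.
  interval_cases a
  · refine ⟨J + D.i * K, ?_⟩
    rw [hσ]
    linear_combination h - K ^ 2 * hi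
  · have h1 : D.σ • ((J + D.i * K) * (1 - D.i)) = (J - D.i * K) * (1 + D.i) := by
      rw [smul_mul', hσ, smul_sub, smul_one, D.σ_i, sub_neg_eq_add]
    refine half h1 (s := J + K) ?_ ?_
    · linear_combination -2 * K * hi
    · linear_combination 2 * h - (J ^ 2 - D.i ^ 2 * K ^ 2 + 2 * K ^ 2) * hi
  · refine half hσ (s := J) ?_ ?_
    · ring
    · linear_combination h - K ^ 2 * hi

/-- Here `θ² = -r`, so the descent takes place in `O[θ]`. Its element `m = (j² + k²)/2ᵃ` is a
relative norm from `L` and has norm `l η²` down to `F₀`. -/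
lemma exists_intNorm_associated [IsGalois F₀ L] (D : BiquadData d.conj L) {l c e x y : 𝓞 F₀}
    (hl : Prime l) (h1 : l = c ^ 2 - d.r * e ^ 2) (h2 : l = x ^ 2 + y ^ 2) :
    ∃ ρ : 𝓞 L, Associated (Algebra.intNorm (𝓞 F₀) (𝓞 L) ρ) l := by
  obtain ⟨j, k, a, η, ha, hη, hn, m, hm⟩ := GoldenData.exists_sq_add_sq_norm hl h1 h2
  have hr := d.conj_r
  obtain ⟨ρ, hρ⟩ := D.exists_mul_σ_eq (m := D.ofQuadratic hr m) (D.σ_ofQuadratic hr j)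
    (D.σ_ofQuadratic hr k) ha (by
      rw [← map_pow, ← map_pow, ← map_add, hm, map_mul, map_pow, map_ofNat])
  have hN := D.intNorm_eq ρ
  rw [hρ, D.ofQuadratic_mul_τ, (FaithfulSMul.algebraMap_injective (𝓞 F₀) (𝓞 L)).eq_iff] at hN
  refine ⟨ρ, ?_⟩
  rw [hN]
  have h4 : ((2 : 𝓞 F₀) ^ a) ^ 2 ≠ 0 := pow_ne_zero _ (pow_ne_zero _ two_ne_zero)
  have h5 : m.norm = l * η ^ 2 := by
    refine mul_left_cancel₀ h4 ?_
    rw [hm, map_mul, map_pow] at hn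
    have h6 : QuadraticAlgebra.norm (2 : QuadraticAlgebra (𝓞 F₀) (-d.r) 0) = 2 ^ 2 := by
      simp [QuadraticAlgebra.norm_def, QuadraticAlgebra.re_ofNat, QuadraticAlgebra.im_ofNat]; ring
    rw [h6, pow_right_comm] at hn
    linear_combination hn
  rw [h5]
  exact (associated_mul_unit_right l _ (hη.pow 2)).symm

end BiquadData

end QuadRep

end

/-! ### The equivalence between representability and splitting -/

noncomputable section

namespace QuadRep

variable {L : Type*} [Field L] [NumberField L] [Algebra F₀ L]

/-- Write `l = ε (c² - r e²)`. Both `l` and `c² - r e²` are positive under `ψ`, so `ε` is `η²` or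
`-w η²`, and `η` is absorbed. -/
lemma GoldenData.rep_or_eq {O : Type*} [CommRing O] (d : GoldenData O) {l t : O} (hl : Prime l)
    (hψ : 0 < d.ψ l) (ht : l ∣ t ^ 2 - d.r) :
    d.Rep l ∨ ∃ c e, l = c ^ 2 - d.r * e ^ 2 := by
  have hr : d.ψ d.r < 0 := by rw [GoldenData.ψ_r, neg_lt_zero]; positivity
  obtain ⟨ε, c, e, hε, h⟩ := d.exists_eq_mul_norm hr d.reducible_r hl ht
  have hψε : 0 < d.ψ ε := by
    rw [h, map_mul] at hψ
    refine (pos_iff_pos_of_mul_pos hψ).2 (lt_of_le_of_ne ?_ (right_ne_zero_of_mul hψ.ne').symm)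
    simp only [map_sub, map_mul, map_pow]
    nlinarith [sq_nonneg (d.ψ c), sq_nonneg (d.ψ e)]
  rcases d.unit_eq_of_ψ_pos hε hψε with ⟨η, -, rfl⟩ | ⟨η, -, rfl⟩
  · exact .inr ⟨η * c, η * e, by rw [h]; ring⟩
  · exact .inl ⟨η * c, η * e, by rw [h]; ring⟩

/-- The unit relating `l` to a sum of two squares is totally positive, hence a square. -/
lemma GoldenData.eq_sq_add_sq {O : Type*} [CommRing O] (d : GoldenData O) {l s : O} (hl : Prime l)
    (hφ : 0 < d.φ l) (hψ : 0 < d.ψ l) (hs : l ∣ s ^ 2 + 1) : ∃ x y, l = x ^ 2 + y ^ 2 := by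
  obtain ⟨ε, c, e, hε, h⟩ := d.exists_eq_mul_norm (D := -1) (by simp) d.reducible_neg_one hl
    (s := s) (by rwa [sub_neg_eq_add])
  have pos : ∀ f : O →+* ℝ, 0 < f l → 0 < f ε := fun f hf ↦ by
    rw [h, map_mul] at hf
    refine (pos_iff_pos_of_mul_pos hf).2 (lt_of_le_of_ne ?_ (right_ne_zero_of_mul hf.ne').symm)
    simp only [map_sub, map_mul, map_pow, map_neg, map_one]
    nlinarith [sq_nonneg (f c), sq_nonneg (f e)]
  obtain ⟨η, -, rfl⟩ := d.unit_eq_sq_of_pos hε (pos _ hφ) (pos _ hψ)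
  exact ⟨η * c, η * e, by rw [h]; ring⟩

/-- A maximal ideal `P` containing `ρ` lies above `lam`, and by complete splitting its norm is
already all of `(lam)`. The cofactor of `P` in `(ρ)` thus has norm `1`, so `P = (ρ)`. -/
lemma isPrincipal_of_intNorm {lam : 𝓞 F₀} (hl : Prime lam)
    (hsplit : SplitsCompletely L (Ideal.span {lam})) {ρ : 𝓞 L}
    (hρ : Associated (Algebra.intNorm (𝓞 F₀) (𝓞 L) ρ) lam) :
    ∃ P ∈ (Ideal.span {lam}).primesOver (𝓞 L), P.IsPrincipal := by
  have := isMaximal_span hl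
  have hrel : Ideal.relNorm (𝓞 F₀) (Ideal.span {ρ}) = Ideal.span {lam} := by
    rw [Ideal.relNorm_singleton, Ideal.span_singleton_eq_span_singleton]
    exact hρ
  have htop : Ideal.span {ρ} ≠ ⊤ := fun h ↦ by
    rw [h, Ideal.relNorm_top] at hrel
    exact this.ne_top hrel.symm
  obtain ⟨P, hPmax, hP⟩ := Ideal.exists_le_maximal _ htop
  have hover : P ∈ (Ideal.span {lam}).primesOver (𝓞 L) := by
    refine ⟨hPmax.isPrime, ⟨?_⟩⟩
    refine this.eq_of_le (Ideal.IsPrime.ne_top inferInstance) ?_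
    rw [← hrel]
    exact (Ideal.relNorm_le_comap _ _).trans (Ideal.comap_mono hP)
  refine ⟨P, hover, ?_⟩
  have hrelP := relNorm_eq_self hover (hsplit P hover).2
  obtain ⟨Q, hQ⟩ := Ideal.dvd_iff_le.2 hP
  have h0 : Ideal.span {lam} ≠ (0 : Ideal (𝓞 F₀)) := by simpa using hl.ne_zero
  have hQ1 : Ideal.relNorm (𝓞 F₀) Q = ⊤ := by
    rw [← Ideal.one_eq_top]
    refine mul_left_cancel₀ h0 ?_
    rwa [mul_one, ← hrelP, ← map_mul, ← hQ, hrelP]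
  have hQ2 : Q = ⊤ := by
    have := Ideal.relNorm_le_comap (𝓞 F₀) Q
    rwa [hQ1, top_le_iff, Ideal.comap_eq_top_iff] at this
  rw [hQ2, Ideal.mul_top] at hQ
  exact ⟨ρ, hQ.symm⟩

/-- If `l` splits completely with no principal prime above it, it is represented. -/
lemma BiquadData.rep_of_splits {d : GoldenData (𝓞 F₀)} [IsGalois F₀ L] (D : BiquadData d.conj L)
    {lam s t : 𝓞 F₀} (hl : Prime lam) (hφ : 0 < d.φ lam) (hψ : 0 < d.ψ lam)
    (hs : lam ∣ s ^ 2 + 1) (ht : lam ∣ t ^ 2 - d.r)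
    (h : SplitsNonPrincipal L (Ideal.span {lam})) : d.Rep lam := by
  refine (d.rep_or_eq hl hψ ht).resolve_right ?_
  rintro ⟨c, e, hce⟩
  obtain ⟨x, y, hxy⟩ := d.eq_sq_add_sq hl hφ hψ hs
  obtain ⟨ρ, hρ⟩ := D.exists_intNorm_associated hl hce hxy
  obtain ⟨P, hP, hP'⟩ := isPrincipal_of_intNorm hl h.1 hρ
  exact h.2 P hP hP'

lemma BiquadData.exists_sq_mod {d : GoldenData (𝓞 F₀)} (D : BiquadData d L)
    {lam : 𝓞 F₀} (hl : Prime lam) (h : SplitsCompletely L (Ideal.span {lam})) :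
    ∃ s t : 𝓞 F₀, lam ∣ s ^ 2 + 1 ∧ lam ∣ t ^ 2 - d.r := by
  have := isMaximal_span hl
  obtain ⟨P, hPmax, hPover⟩ :=
    Ideal.exists_maximal_ideal_liesOver_of_isIntegral (S := 𝓞 L) (Ideal.span {lam})
  have hP : P ∈ (Ideal.span {lam}).primesOver (𝓞 L) := ⟨hPmax.isPrime, hPover⟩
  have hmem : ∀ {x : 𝓞 F₀}, algebraMap (𝓞 F₀) (𝓞 L) x ∈ P → lam ∣ x := fun {x} hx ↦
    Ideal.mem_span_singleton.1 ((algebraMap_mem_iff hP).1 hx)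
  obtain ⟨s, hs⟩ := exists_sub_mem (I := Ideal.span {lam}) (h P hP).2 D.i
  obtain ⟨t, ht⟩ := exists_sub_mem (I := Ideal.span {lam}) (h P hP).2 D.θ
  refine ⟨s, t, hmem ?_, hmem ?_⟩
  · convert! P.mul_mem_left (-(D.i + algebraMap _ _ s)) hs using 1
    simp only [map_add, map_pow, map_one]
    linear_combination D.i_sq
  · convert! P.mul_mem_left (-(D.θ + algebraMap _ _ t)) ht using 1
    simp only [map_sub, map_pow, ← D.θ_sq]
    ring

lemma representable_iff_splits [IsGalois F₀ L] (D : BiquadData goldenF₀ L) {lam : 𝓞 F₀}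
    (hl : Prime lam) (hφ : 0 < goldenF₀.φ lam) (hψ : 0 < goldenF₀.ψ lam)
    (hcop : IsCoprime lam (2 * sqrt5Int)) :
    goldenF₀.Rep lam ∧ goldenF₀.conj.Rep lam ↔ SplitsNonPrincipal L (Ideal.span {lam}) := by
  have h2 : ¬ lam ∣ 2 := fun h ↦ hl.not_isUnit (hcop.of_mul_right_left.isUnit_of_dvd h)
  have hlr : ¬ lam ∣ goldenF₀.r := fun h ↦
    hl.not_isUnit (hcop.of_mul_right_right.isUnit_of_dvd (goldenF₀_r ▸ h))
  have hrl : ¬ goldenF₀.r ∣ lam := fun h ↦ goldenF₀.prime_r.not_isUnit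
    (hcop.of_mul_right_right.symm.isUnit_of_dvd' (goldenF₀_r ▸ dvd_rfl) h)
  constructor
  · rintro ⟨h, h'⟩
    obtain ⟨s, hs⟩ := GoldenData.exists_sq_neg_one_mod hl hlr h h'
    obtain ⟨t, ht⟩ := h.exists_sq_mod hl
    have hsplit := splitsCompletely D hl h2 hlr hs ht
    exact ⟨hsplit, fun P hP ↦ D.not_isPrincipal hl hφ hψ h hrl hP (hsplit P hP).2⟩
  · intro h
    obtain ⟨s, t, hs, ht⟩ := D.exists_sq_mod hl h.1
    -- `(st)² ≡ -r`, which is the square root of `5` of the conjugate data.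
    have ht' : lam ∣ (s * t) ^ 2 - goldenF₀.conj.r := by
      rw [goldenF₀.conj_r]
      convert! (hs.mul_right (t ^ 2)).sub ht using 1
      ring
    exact ⟨D.conj.rep_of_splits hl hφ hψ hs ht h,
      BiquadData.rep_of_splits (d := goldenF₀.conj) D.conj.conj hl hψ hφ hs ht' h⟩

end QuadRep

end

open QuadRep in
theorem mainTheorem10 (L : Type*) [Field L] [NumberField L] [Algebra F₀ L]
    [Polynomial.IsSplittingField ℚ L (Polynomial.X ^ 4 - 5)]
    (lam : 𝓞 F₀) (hpos : TotallyPositive lam) (hirr : Irreducible lam) :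
    (IsCoprime lam (2 * sqrt5Int) →
      ((Representable lam ∧ RepresentableConj lam) ↔ SplitsNonPrincipal L (Ideal.span {lam}))) ∧
    ((4 : 𝓞 F₀) ∣ lam - (-1) → Representable lam → RepresentableConj lam →
      ∃ x y x' y' : F₀, q x y = lam ∧ qConj x' y' = lam ∧
        ∃ x₁ d₁ x₁' d₁' : 𝓞 F₀,
          (x₁ : F₀) = 2 * x ∧ (d₁ : F₀) = y + u * x ∧
          (x₁' : F₀) = 2 * x' ∧ (d₁' : F₀) = y' + uConj * x' ∧
          (2 : 𝓞 F₀) ∣ x₁ ∧ (2 : 𝓞 F₀) ∣ d₁ - uInt ∧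
          (2 : 𝓞 F₀) ∣ x₁' ∧ (2 : 𝓞 F₀) ∣ d₁' - uConjInt) := by
  have := goldenF₀.isPrincipalIdealRing
  have hl : Prime lam := hirr.prime
  have hφ : 0 < goldenF₀.φ lam := hpos emb₁
  have hψ : 0 < goldenF₀.ψ lam := hpos emb₂
  rw [representable_iff hl.ne_zero, representableConj_iff hl.ne_zero]
  have := isGalois_of_isSplittingField (L := L)
  obtain ⟨D⟩ := nonempty_biquadData (L := L)
  refine ⟨representable_iff_splits D hl hφ hψ, ?_⟩
  rw [sub_neg_eq_add]
  rintro h4 ⟨a, b, hab⟩ ⟨a', b', hab'⟩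
  obtain ⟨a, b, hab, ha, hb⟩ := goldenF₀.exists_rep_mod_two hab h4
  obtain ⟨a', b', hab', ha', hb'⟩ := goldenF₀.conj.exists_rep_mod_two hab' h4
  rw [goldenF₀_conj_w] at hab' hb'
  rw [goldenF₀.conj_r, goldenF₀_r] at hab'
  rw [goldenF₀_r] at hab
  have h1 := congrArg (algebraMap (𝓞 F₀) F₀) hab
  have h1' := congrArg (algebraMap (𝓞 F₀) F₀) hab'
  -- The inverse of the change of variables `x₁ = 2x`, `d₁ = y + u x`, and its conjugate.
  refine ⟨a / 2, b - u * (a / 2), a' / 2, b' - uConj * (a' / 2), ?_, ?_, a, b, a', b',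
    by ring, by ring, by ring, by ring, ha, hb, ha', hb'⟩
  · refine Eq.trans ?_ h1.symm
    rw [q_eq]
    simp only [map_mul, map_sub, map_pow, coe_sqrt5Int]
    change _ = u * _
    ring
  · refine Eq.trans ?_ h1'.symm
    rw [qConj_eq]
    simp only [map_mul, map_sub, map_pow, map_neg, coe_sqrt5Int, coe_uConjInt]
    ring
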